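/- Let $C\subset\mathbb R^n$ be a closed convex cone with interior points that contains no line, and let $K\subset\mathbb R^n$ be a $C$-pseudo-cone, that is, a nonempty closed convex set with $o\notin K$, $\lambda K\subseteq K$ for all $\lambda\ge 1$, and recession cone $C$. Let $$K^*=\{u\in\mathbb R^n:\langle u,x\rangle\le -1\text{ for all }x\in K\}$$ be its copolar set. For a closed convex set $L\subset\mathbb R^n$ the boundary $\partial L$ is said to be of class $C^2_+$ if it is a hypersurface of class $C^2$ whose Gauss curvature $\kappa(L,x)$ (the determinant of the differential of the outer unit normal map on the tangent hyperplane) is positive at every $x\in\partial L$. Denoting by $\nu_L(x)$ the outer unit normal vector of $L$ at $x$, the equiaffine support function of $L$ is then $$\varrho_{\rm aff}(L,x)=\frac{\langle x,\nu_L(x)\rangle}{\kappa(L,x)^{1/(n+1)}},\qquad x\in\partial L,$$ and $\partial L$ is called an affine hypersphere (with centre $o$) if it is of class $C^2_+$ and $\varrho_{\rm aff}(L,\cdot)$ is constant on $\partial L$. If $\partial K$ is an affine hypersphere, then $\partial K^*$ is also an affine hypersphere. -/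

import Mathlib

open scoped RealInnerProductSpace Gradient Topology

noncomputable section

/-- The copolar set `K^* = {u : ⟪u, x⟫ ≤ -1 for all x ∈ K}`. -/
def copolar {n : ℕ} (K : Set (EuclideanSpace ℝ (Fin n))) : Set (EuclideanSpace ℝ (Fin n)) :=
  {u | ∀ x ∈ K, ⟪u, x⟫ ≤ -1}

/-- A pseudo-cone: a nonempty closed convex set `K` with `0 ∉ K` and `t K ⊆ K` for `t ≥ 1`. -/
structure IsPseudoCone {n : ℕ} (K : Set (EuclideanSpace ℝ (Fin n))) : Prop where
  nonempty : K.Nonempty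
  isClosed : IsClosed K
  convex : Convex ℝ K
  zero_notMem : (0 : EuclideanSpace ℝ (Fin n)) ∉ K
  smul_mem : ∀ t : ℝ, 1 ≤ t → ∀ x ∈ K, t • x ∈ K

/-- The recession cone of a set: all `y` with `x + t y ∈ K` for all `x ∈ K`, `t ≥ 0`. -/
def recessionCone {n : ℕ} (K : Set (EuclideanSpace ℝ (Fin n))) :
    Set (EuclideanSpace ℝ (Fin n)) :=
  {y | ∀ x ∈ K, ∀ t : ℝ, 0 ≤ t → x + t • y ∈ K}

/-- `K` is a `C`-pseudo-cone: a pseudo-cone whose recession cone is `C`, where the closed convex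
cone `C` contains no line and has interior points. -/
structure IsCPseudoCone {n : ℕ} (C : ProperCone ℝ (EuclideanSpace ℝ (Fin n)))
    (K : Set (EuclideanSpace ℝ (Fin n))) : Prop where
  isPseudoCone : IsPseudoCone K
  recessionCone_eq : recessionCone K = (C : Set (EuclideanSpace ℝ (Fin n)))
  pointed : ∀ x ∈ C, -x ∈ C → x = 0
  interior_nonempty : (interior (C : Set (EuclideanSpace ℝ (Fin n)))).Nonempty

/-- `u` is an outer unit normal vector of `K` at `x`. -/
def IsOuterUnitNormal {n : ℕ} (K : Set (EuclideanSpace ℝ (Fin n)))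
    (x u : EuclideanSpace ℝ (Fin n)) : Prop :=
  ‖u‖ = 1 ∧ ∀ y ∈ K, ⟪u, y - x⟫ ≤ 0

open Classical in
/-- The outer unit normal vector `ν_K(x)`; it is unique at a boundary point `x` of a convex set
`K` whose boundary is smooth at `x`. -/
def outerUnitNormal {n : ℕ} (K : Set (EuclideanSpace ℝ (Fin n)))
    (x : EuclideanSpace ℝ (Fin n)) : EuclideanSpace ℝ (Fin n) :=
  if h : ∃ u, IsOuterUnitNormal K x u then h.choose else 0

/-- `φ` is a local defining function of class `C²` of the set `K` at the boundary point `x`: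
near `x`, the set `K` is `{φ ≤ 0}`, and the gradient of `φ` does not vanish at `x`. -/
structure IsC2DefiningAt {n : ℕ} (K : Set (EuclideanSpace ℝ (Fin n)))
    (φ : EuclideanSpace ℝ (Fin n) → ℝ) (x : EuclideanSpace ℝ (Fin n)) : Prop where
  contDiffAt : ContDiffAt ℝ 2 φ x
  eq_zero : φ x = 0
  gradient_ne_zero : ∇ φ x ≠ 0
  eventually_mem_iff : ∀ᶠ y in 𝓝 x, (y ∈ K ↔ φ y ≤ 0)

/-- The unit normal field of the level sets of `φ`, pointing out of the sublevel sets. -/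
def levelNormal {n : ℕ} (φ : EuclideanSpace ℝ (Fin n) → ℝ)
    (y : EuclideanSpace ℝ (Fin n)) : EuclideanSpace ℝ (Fin n) :=
  ‖∇ φ y‖⁻¹ • ∇ φ y

/-- The tangent hyperplane (as a linear subspace) at `x` of the level set of `φ` through `x`. -/
def levelTangent {n : ℕ} (φ : EuclideanSpace ℝ (Fin n) → ℝ)
    (x : EuclideanSpace ℝ (Fin n)) : Submodule ℝ (EuclideanSpace ℝ (Fin n)) :=
  (ℝ ∙ ∇ φ x)ᗮ

/-- The Weingarten map of the level set of `φ` through `x`: the differential of the unit normal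
field, as an endomorphism of the tangent hyperplane. (The derivative of a field of unit vectors
takes values in the tangent hyperplane; the orthogonal projection only adjusts the codomain.)
With respect to the normal pointing out of `{φ ≤ 0}`, it is positive semidefinite if this set is
convex. -/
def weingartenMap {n : ℕ} (φ : EuclideanSpace ℝ (Fin n) → ℝ)
    (x : EuclideanSpace ℝ (Fin n)) : levelTangent φ x →ₗ[ℝ] levelTangent φ x :=
  (levelTangent φ x).orthogonalProjectionOnto.toLinearMap ∘ₗ
    (fderiv ℝ (levelNormal φ) x).toLinearMap ∘ₗ (levelTangent φ x).subtype

open Classical in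
/-- The Gauss curvature `κ(K, x)` of the boundary of `K` at a boundary point `x` where it is of
class `C²`: the determinant of the Weingarten map with respect to the outer unit normal. It does
not depend on the defining function that is used. -/
def gaussCurvature {n : ℕ} (K : Set (EuclideanSpace ℝ (Fin n)))
    (x : EuclideanSpace ℝ (Fin n)) : ℝ :=
  if h : ∃ φ, IsC2DefiningAt K φ x then LinearMap.det (weingartenMap h.choose x) else 0

/-- The boundary of `K` is a hypersurface of class `C²_+`: of class `C²` with positive Gauss
curvature everywhere. -/
def HasC2PlusBoundary {n : ℕ} (K : Set (EuclideanSpace ℝ (Fin n))) : Prop :=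
  ∀ x ∈ frontier K, (∃ φ, IsC2DefiningAt K φ x) ∧ 0 < gaussCurvature K x

/-- The equiaffine support function `⟪x, ν_K(x)⟫ / κ(K, x) ^ (1 / (n + 1))`. -/
def equiaffineSupport {n : ℕ} (K : Set (EuclideanSpace ℝ (Fin n)))
    (x : EuclideanSpace ℝ (Fin n)) : ℝ :=
  ⟪x, outerUnitNormal K x⟫ / gaussCurvature K x ^ (1 / ((n : ℝ) + 1))

/-- The boundary of `K` is an affine hypersphere (with centre `0`): it is of class `C²_+`, and the
equiaffine support function is constant on it. -/
structure IsAffineHypersphereBoundary {n : ℕ} (K : Set (EuclideanSpace ℝ (Fin n))) : Prop where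
  c2Plus : HasC2PlusBoundary K
  equiaffineSupport_const : ∃ c : ℝ, ∀ x ∈ frontier K, equiaffineSupport K x = c

end

/-! Local duality. Let h be the support function of K, let x be a boundary point of K, and let u be
a normal vector at x scaled so that ⟨u, x⟩ = -1. Near u, K* is the set {h ≤ -1}. The gradient of h
is the inverse Gauss map X of K, so the outer normal of K* at u is x/|x|. The Weingarten map of K at
x and the differential of X at u are inverse to each other on the tangent hyperplane, up to the
factor 1/|u|. A determinant computation (`det_borderedMap_mul_det_borderedMap`) then yields κ(K,x)
κ(K*,u) = (|x||u|)^{-(n+1)}. Since ⟨x, ν_K⟩ = -1/|u| and ⟨u, ν_{K*}⟩ = -1/|x|, the two equiaffine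
support functions have product 1, and a constant c for K becomes c⁻¹ for K*.

Global part. Every boundary point u of K* must be such a normal vector, that is, the supremum -1 of
⟨u, ·⟩ over K must be attained. This can fail only if ⟨u, y⟩ = 0 for some nonzero y in C, which
`inner_neg_of_mem_copolar` excludes by a Monge–Ampère barrier argument. On the compact slice ⟨w, e⟩
= -1 of the polar cone, h is touched from below by a quadratic function whose second derivative
along y is as large as desired, at a point w where h is still bounded away from 0. There the Hessian
determinant of h is large, hence the curvature of K is small; but constancy of the equiaffine
support function bounds that curvature from below. With strict negativity on C, a compactness
argument gives attainment. -/

/-! ### Determinants of compressions and rank-one perturbations -/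

section LinearAlgebra

variable {V : Type*} [NormedAddCommGroup V] [InnerProductSpace ℝ V]

/-- The linear map that agrees with `A` on the orthogonal complement of the unit vector `g` and
fixes `g`. -/
noncomputable def borderedMap (g : V) (A : V →ₗ[ℝ] V) : V →ₗ[ℝ] V :=
  A ∘ₗ (LinearMap.id - (innerₛₗ ℝ g).smulRight g) + (innerₛₗ ℝ g).smulRight g

theorem borderedMap_apply (g : V) (A : V →ₗ[ℝ] V) (v : V) :
    borderedMap g A v = A (v - ⟪g, v⟫ • g) + ⟪g, v⟫ • g := by
  simp [borderedMap]

/-- The compression of an endomorphism to a subspace. -/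
noncomputable def compression (S : Submodule ℝ V) [S.HasOrthogonalProjection] (A : V →ₗ[ℝ] V) :
    S →ₗ[ℝ] S :=
  S.orthogonalProjectionOnto.toLinearMap ∘ₗ A ∘ₗ S.subtype

theorem inner_self_of_norm_eq_one {g : V} (hg : ‖g‖ = 1) : ⟪g, g⟫ = 1 := by
  rw [real_inner_self_eq_norm_sq, hg, one_pow]

variable [FiniteDimensional ℝ V]

/-- The bordered map fixes g, so its determinant is that of the map induced on V/ℝg, which is
conjugate to the compression to the complement of g. Curvatures living on different tangent
hyperplanes thus become determinants on one space and can be multiplied. -/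
theorem det_compression_eq_det_borderedMap {g : V} (hg : ‖g‖ = 1) (A : V →ₗ[ℝ] V)
    {S : Submodule ℝ V} [S.HasOrthogonalProjection] (hS : S = (ℝ ∙ g)ᗮ) :
    LinearMap.det (compression S A) = LinearMap.det (borderedMap g A) := by
  subst hS
  have hgg := inner_self_of_norm_eq_one hg
  have hfix : borderedMap g A g = g := by
    rw [borderedMap_apply, hgg]; simp
  have hfix' : ∀ w ∈ (ℝ ∙ g), borderedMap g A w = w := by
    intro w hw
    obtain ⟨a, rfl⟩ := Submodule.mem_span_singleton.1 hw
    rw [map_smul, hfix]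
  have hW : (ℝ ∙ g) ≤ (ℝ ∙ g).comap (borderedMap g A) := by
    intro w hw
    rw [Submodule.mem_comap, hfix' w hw]
    exact hw
  rw [LinearMap.det_eq_det_mul_det (ℝ ∙ g) (borderedMap g A) hW]
  have h1 : (borderedMap g A).restrict hW = LinearMap.id := by
    ext w
    simp [LinearMap.restrict_apply, hfix' w w.2]
  rw [h1, LinearMap.det_id, one_mul]
  have hc : IsCompl (ℝ ∙ g) (ℝ ∙ g)ᗮ := Submodule.isCompl_orthogonal _
  set e := Submodule.quotientEquivOfIsCompl (ℝ ∙ g) (ℝ ∙ g)ᗮ hc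
  rw [← LinearMap.det_conj ((ℝ ∙ g).mapQ (ℝ ∙ g) (borderedMap g A) hW) e]
  congr 1
  ext1 s
  apply e.symm.injective
  have hs : ⟪g, (s : V)⟫ = 0 := Submodule.mem_orthogonal_singleton_iff_inner_right.1 s.2
  simp only [compression, LinearMap.comp_apply, LinearEquiv.coe_coe, e,
    LinearEquiv.symm_apply_apply,
    Submodule.quotientEquivOfIsCompl_symm_apply, Submodule.mapQ_apply, borderedMap_apply, hs,
    zero_smul, sub_zero, add_zero, Submodule.subtype_apply]
  rw [Submodule.Quotient.eq, ← neg_mem_iff, neg_sub]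
  have := (ℝ ∙ g)ᗮ.sub_starProjection_mem_orthogonal (A s)
  rwa [Submodule.orthogonal_orthogonal] at this

theorem det_id_add_smulRight (v a : V) :
    LinearMap.det (LinearMap.id + (innerₛₗ ℝ v).smulRight a) = 1 + ⟪v, a⟫ := by
  have : LinearMap.id + (innerₛₗ ℝ v).smulRight a = LinearMap.transvection (innerₛₗ ℝ v) a := by
    ext w
    simp [LinearMap.transvection.apply]
  rw [this, LinearMap.transvection.det]
  simp

/-- The determinant of `r` times the projection orthogonal to `ν`, corrected by `w ν^T`. -/
theorem det_smul_add_smulRight {ν w : V} {r : ℝ} (hν : ‖ν‖ = 1) (hr : r ≠ 0) (hw : ⟪ν, w⟫ = 1) :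
    r * LinearMap.det (r • LinearMap.id + (innerₛₗ ℝ ν).smulRight (w - r • ν)) =
      r ^ Module.finrank ℝ V := by
  have h : r • LinearMap.id + (innerₛₗ ℝ ν).smulRight (w - r • ν) =
      r • (LinearMap.id + (innerₛₗ ℝ ν).smulRight (r⁻¹ • w - ν)) := by
    ext v
    simp only [LinearMap.add_apply, LinearMap.smul_apply, LinearMap.id_apply,
      LinearMap.smulRight_apply]
    match_scalars <;> field_simp
  rw [h, LinearMap.det_smul, det_id_add_smulRight, inner_sub_right, inner_smul_right, hw,
    inner_self_of_norm_eq_one hν]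
  field_simp
  ring

/-- Linear algebra behind the curvature product: A is the differential of the normal field of K, D
that of the inverse Gauss map, and μ the normal of K*. The factor ⟨ν, μ⟩² accounts for the angle
between the two tangent hyperplanes. The extra k * d on the left avoids the exponent n - 1. -/
theorem det_borderedMap_mul_det_borderedMap {ν μ : V} {A D : V →ₗ[ℝ] V} {d k : ℝ}
    (hν : ‖ν‖ = 1) (hμ : ‖μ‖ = 1) (hA : ∀ v, ⟪ν, A v⟫ = 0) (hD : ∀ v, ⟪ν, D v⟫ = 0)
    (hAD : ∀ v, A (D v) = d • (v - ⟪ν, v⟫ • ν)) (hdk : k * d ≠ 0) (hc : ⟪ν, μ⟫ ≠ 0) :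
    (k * d) * (LinearMap.det (borderedMap ν A) * LinearMap.det (borderedMap μ (k • D))) =
      (k * d) ^ Module.finrank ℝ V * ⟪ν, μ⟫ ^ 2 := by
  have hνν := inner_self_of_norm_eq_one hν
  have hμμ := inner_self_of_norm_eq_one hμ
  set c := ⟪ν, μ⟫ with hcdef
  have hcμ : ⟪μ, ν⟫ = c := real_inner_comm _ _
  set w : V := c⁻¹ • A (μ - c • ν) + ν with hw
  have hw1 : ⟪ν, w⟫ = 1 := by
    rw [hw, inner_add_right, inner_smul_right, hA, hνν]; ring
  set a : V := (2 * c) • ν - μ with ha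
  -- Here a is the reflection of μ in the line ℝν, and w absorbs the term A(μ - cν), which does not
  -- affect the determinant because only ⟨ν, w⟩ = 1 enters. The last two factors have determinants
  -- 2c² and 1/2.
  have hprod : borderedMap ν A ∘ₗ borderedMap μ (k • D) =
      ((k * d) • LinearMap.id + (innerₛₗ ℝ ν).smulRight (w - (k * d) • ν)) ∘ₗ
      ((LinearMap.id + (innerₛₗ ℝ μ).smulRight a) ∘ₗ
        (LinearMap.id + (innerₛₗ ℝ ν).smulRight (-(2 * c)⁻¹ • μ))) := by
    ext v
    have hZ : (LinearMap.id + (innerₛₗ ℝ μ).smulRight a : V →ₗ[ℝ] V)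
        ((LinearMap.id + (innerₛₗ ℝ ν).smulRight (-(2 * c)⁻¹ • μ) : V →ₗ[ℝ] V) v) =
        v - ⟪ν, v⟫ • ν + ⟪μ, v⟫ • a := by
      simp only [LinearMap.add_apply, LinearMap.id_apply, LinearMap.smulRight_apply,
        innerₛₗ_apply_apply, inner_add_right, inner_smul_right, hμμ, ha, smul_sub, smul_smul]
      match_scalars <;> field_simp <;> ring
    rw [LinearMap.comp_apply, LinearMap.comp_apply, LinearMap.comp_apply, hZ]
    have hb : borderedMap μ (k • D) v = k • D (v - ⟪μ, v⟫ • μ) + ⟪μ, v⟫ • μ := by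
      rw [borderedMap_apply]; rfl
    have hin : ⟪ν, v - ⟪ν, v⟫ • ν + ⟪μ, v⟫ • a⟫ = ⟪μ, v⟫ * c := by
      simp only [ha, inner_add_right, inner_sub_right, inner_smul_right, hνν, ← hcdef]; ring
    have hin2 : ⟪ν, k • D (v - ⟪μ, v⟫ • μ) + ⟪μ, v⟫ • μ⟫ = ⟪μ, v⟫ * c := by
      simp only [inner_add_right, inner_smul_right, hD, ← hcdef]; ring
    rw [hb, borderedMap_apply, hin2]
    simp only [LinearMap.add_apply, LinearMap.smul_apply, LinearMap.id_apply,
      LinearMap.smulRight_apply, innerₛₗ_apply_apply, hin]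
    have e1 : k • D (v - ⟪μ, v⟫ • μ) + ⟪μ, v⟫ • μ - (⟪μ, v⟫ * c) • ν =
        k • D (v - ⟪μ, v⟫ • μ) + ⟪μ, v⟫ • (μ - c • ν) := by module
    rw [e1, map_add, map_smul, map_smul, hAD, hw, ha]
    simp only [inner_sub_right, inner_smul_right, ← hcdef]
    match_scalars <;> field_simp <;> ring
  have hdet := congrArg LinearMap.det hprod
  rw [LinearMap.det_comp, LinearMap.det_comp, LinearMap.det_comp, det_id_add_smulRight,
    det_id_add_smulRight] at hdet
  rw [hdet, ← mul_assoc, det_smul_add_smulRight hν hdk hw1, ha, inner_sub_right, inner_smul_right,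
    inner_smul_right, hcμ, hμμ, ← hcdef]
  field_simp
  ring

theorem det_borderedMap_mul_det_borderedMap_self {ν : V} {A D : V →ₗ[ℝ] V} {d : ℝ}
    (hν : ‖ν‖ = 1) (hA : ∀ v, ⟪ν, A v⟫ = 0) (hD : ∀ v, ⟪ν, D v⟫ = 0)
    (hAD : ∀ v, A (D v) = d • (v - ⟪ν, v⟫ • ν)) (hd : d ≠ 0) :
    d * (LinearMap.det (borderedMap ν A) * LinearMap.det (borderedMap ν D)) =
      d ^ Module.finrank ℝ V := by
  have := det_borderedMap_mul_det_borderedMap (k := 1) hν hν hA hD hAD (by simpa) (by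
    rw [inner_self_of_norm_eq_one hν]; exact one_ne_zero)
  simpa [hν] using this

/-- All eigenvalues are at least ε, and one is at least b, since otherwise the Rayleigh quotient of
z would be less than b. -/
theorem LinearMap.IsSymmetric.le_det {A : V →ₗ[ℝ] V} (hA : A.IsSymmetric) {ε b : ℝ} (hε : 0 ≤ ε)
    (hb : 0 ≤ b) (h : ∀ v, ε * ‖v‖ ^ 2 ≤ ⟪A v, v⟫) {z : V} (hz : z ≠ 0)
    (hzb : b * ‖z‖ ^ 2 ≤ ⟪A z, z⟫) :
    ε ^ (Module.finrank ℝ V - 1) * b ≤ LinearMap.det A := by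
  classical
  set m := Module.finrank ℝ V with hm
  have hev : ∀ i, ε ≤ hA.eigenvalues hm.symm i := by
    intro i
    have h1 := h (hA.eigenvectorBasis hm.symm i)
    rw [hA.apply_eigenvectorBasis, (hA.eigenvectorBasis hm.symm).norm_eq_one] at h1
    simpa [inner_smul_left, real_inner_self_eq_norm_sq,
      (hA.eigenvectorBasis hm.symm).norm_eq_one] using h1
  obtain ⟨i, hi⟩ : ∃ i, b ≤ hA.eigenvalues hm.symm i := by
    by_contra! hlt
    set B := hA.eigenvectorBasis hm.symm
    have hsum : ⟪A z, z⟫ = ∑ i, hA.eigenvalues hm.symm i * ⟪B i, z⟫ ^ 2 := by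
      rw [← B.sum_inner_mul_inner (A z) z]
      refine Finset.sum_congr rfl fun i _ => ?_
      rw [hA z (B i), hA.apply_eigenvectorBasis, inner_smul_right, real_inner_comm]
      simp only [RCLike.ofReal_real_eq_id, id_eq, B]
      ring
    have hnorm : ‖z‖ ^ 2 = ∑ i, ⟪B i, z⟫ ^ 2 := (B.sum_sq_inner_right z).symm
    have hpos : 0 < ‖z‖ ^ 2 := by positivity
    have : ⟪A z, z⟫ < b * ‖z‖ ^ 2 := by
      rw [hsum, hnorm, Finset.mul_sum]
      rw [hnorm] at hpos
      obtain ⟨j, -, hj⟩ := Finset.exists_ne_zero_of_sum_ne_zero hpos.ne'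
      refine Finset.sum_lt_sum (fun i _ => mul_le_mul_of_nonneg_right (hlt i).le (sq_nonneg _))
        ⟨j, Finset.mem_univ j, mul_lt_mul_of_pos_right (hlt j) ?_⟩
      exact lt_of_le_of_ne (sq_nonneg _) hj.symm
    linarith
  have hdet := hA.det_eq_prod_eigenvalues hm.symm
  rw [hdet, ← Finset.mul_prod_erase _ _ (Finset.mem_univ i), mul_comm]
  simp only [RCLike.ofReal_real_eq_id, id_eq]
  have hcard : (Finset.univ.erase i).card = m - 1 := by simp
  refine mul_le_mul hi ?_ (by positivity) (hb.trans hi)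
  rw [← hcard, ← Finset.prod_const]
  exact Finset.prod_le_prod (fun _ _ => hε) fun j _ => hev j

end LinearAlgebra

/-! ### Normals and curvature through local defining functions -/

section Convex

open Filter

variable {n : ℕ} {K : Set (EuclideanSpace ℝ (Fin n))} {φ : EuclideanSpace ℝ (Fin n) → ℝ}
  {x y u : EuclideanSpace ℝ (Fin n)}

theorem hasDerivAt_comp_line (hφ : DifferentiableAt ℝ φ y) (w : EuclideanSpace ℝ (Fin n)) :
    HasDerivAt (fun t : ℝ => φ (y + t • w)) ⟪∇ φ y, w⟫ 0 := by
  have h1 : HasDerivAt (fun t : ℝ => y + t • w) w 0 := by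
    simpa using ((hasDerivAt_id (0 : ℝ)).smul_const w).const_add y
  have h2 : HasFDerivAt φ (fderiv ℝ φ y) (y + (0 : ℝ) • w) := by
    simpa using hφ.hasFDerivAt
  have := h2.comp_hasDerivAt (0 : ℝ) h1
  rw [inner_gradient_left]
  exact this

theorem tendsto_line (y w : EuclideanSpace ℝ (Fin n)) :
    Tendsto (fun t : ℝ => y + t • w) (𝓝[>] 0) (𝓝 y) := by
  have : Continuous fun t : ℝ => y + t • w := by fun_prop
  have h := this.tendsto 0
  simp only [zero_smul, add_zero] at h
  exact h.mono_left nhdsWithin_le_nhds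

/-- The gradient of a local defining function is an outer normal vector. -/
theorem inner_gradient_nonpos (hK : Convex ℝ K) (hφ : DifferentiableAt ℝ φ y) (hy : φ y = 0)
    (hKφ : ∀ᶠ z in 𝓝 y, (z ∈ K ↔ φ z ≤ 0)) {z : EuclideanSpace ℝ (Fin n)} (hz : z ∈ K) :
    ⟪∇ φ y, z - y⟫ ≤ 0 := by
  have hyK : y ∈ K := hKφ.self_of_nhds.2 hy.le
  have hd := (hasDerivAt_comp_line hφ (z - y)).tendsto_slope_zero_right
  refine le_of_tendsto hd ?_
  filter_upwards [(tendsto_line y (z - y)).eventually hKφ, self_mem_nhdsWithin,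
    nhdsWithin_le_nhds (Iio_mem_nhds (zero_lt_one' ℝ))] with t ht ht0 ht1
  have hmem : y + t • (z - y) ∈ K :=
    hK.add_smul_sub_mem hyK hz ⟨(Set.mem_Ioi.1 ht0).le, (Set.mem_Iio.1 ht1).le⟩
  have h0 : (0 : ℝ) < t := ht0
  simp only [zero_add, zero_smul, add_zero, hy, sub_zero, smul_eq_mul]
  exact mul_nonpos_of_nonneg_of_nonpos (inv_nonneg.2 h0.le) (ht.1 hmem)

theorem norm_levelNormal (h : ∇ φ y ≠ 0) : ‖levelNormal φ y‖ = 1 := by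
  rw [levelNormal, norm_smul, norm_inv, norm_norm, inv_mul_cancel₀ (norm_ne_zero_iff.2 h)]

theorem gradient_eq_smul_levelNormal (h : ∇ φ y ≠ 0) : ∇ φ y = ‖∇ φ y‖ • levelNormal φ y := by
  rw [levelNormal, smul_smul, mul_inv_cancel₀ (norm_ne_zero_iff.2 h), one_smul]

/-- Uniqueness of the outer unit normal vector at a regular point. -/
theorem IsOuterUnitNormal.eq_levelNormal (hu : IsOuterUnitNormal K y u)
    (hφ : DifferentiableAt ℝ φ y) (hy : y ∈ K) (hg : ∇ φ y ≠ 0)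
    (hKφ : ∀ᶠ z in 𝓝 y, (z ∈ K ↔ φ z ≤ 0)) : u = levelNormal φ y := by
  set g := levelNormal φ y with hgdef
  have hg1 : ‖g‖ = 1 := norm_levelNormal hg
  have hgg := inner_self_of_norm_eq_one hg1
  have hgrad := gradient_eq_smul_levelNormal hg
  have hpos : 0 < ‖∇ φ y‖ := norm_pos_iff.2 hg
  have hy0 : φ y ≤ 0 := hKφ.self_of_nhds.1 hy
  -- Directions w with ⟨g, w⟩ < 0 point into K, so the half-space of g lies in that of u; two unit
  -- normals with this property coincide.
  have key : ∀ w, ⟪g, w⟫ < 0 → ⟪u, w⟫ ≤ 0 := by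
    intro w hw
    have hw' : ⟪∇ φ y, w⟫ < 0 := by
      rw [hgrad, real_inner_smul_left]; exact mul_neg_of_pos_of_neg hpos hw
    have hd := (hasDerivAt_comp_line hφ w).tendsto_slope_zero_right
    have hev := hd.eventually (Iio_mem_nhds hw')
    obtain ⟨t, ht1, ht0, htK⟩ := (hev.and ((eventually_mem_nhdsWithin (a := (0 : ℝ))
      (s := Set.Ioi 0)).and ((tendsto_line y w).eventually hKφ))).exists
    have h0 : (0 : ℝ) < t := ht0
    simp only [zero_add, zero_smul, add_zero, smul_eq_mul] at ht1
    have h2 : φ (y + t • w) - φ y < 0 := by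
      by_contra! h
      exact absurd ht1 (not_lt.2 (mul_nonneg (inv_nonneg.2 h0.le) h))
    have h3 := hu.2 _ (htK.2 (by linarith))
    rw [add_sub_cancel_left, real_inner_smul_right] at h3
    exact nonpos_of_mul_nonpos_right h3 h0
  have key' : ∀ w, ⟪g, w⟫ ≤ 0 → ⟪u, w⟫ ≤ 0 := by
    intro w hw
    have hlim : Tendsto (fun s : ℝ => ⟪u, w + s • (-g)⟫) (𝓝[>] 0) (𝓝 ⟪u, w⟫) :=
      tendsto_const_nhds.inner (tendsto_line w (-g))
    refine le_of_tendsto hlim ?_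
    filter_upwards [self_mem_nhdsWithin] with s hs
    apply key
    rw [inner_add_right, real_inner_smul_right, inner_neg_right, hgg]
    have : (0 : ℝ) < s := hs
    linarith
  have h1 : 0 ≤ ⟪u, g⟫ := by
    have := key' (-g) (by rw [inner_neg_right, hgg]; norm_num)
    rw [inner_neg_right] at this; linarith
  have h2 : ⟪u, u - ⟪u, g⟫ • g⟫ ≤ 0 := key' _ (by
    rw [inner_sub_right, real_inner_smul_right, hgg, real_inner_comm u g]; simp)
  rw [inner_sub_right, real_inner_smul_right, inner_self_of_norm_eq_one hu.1] at h2
  have h3 : 1 ≤ ⟪u, g⟫ := by nlinarith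
  have h4 : ‖u - g‖ ^ 2 ≤ 0 := by
    rw [norm_sub_sq_real, hu.1, hg1]; linarith
  have h5 : ‖u - g‖ = 0 := by nlinarith [norm_nonneg (u - g)]
  exact sub_eq_zero.1 (norm_eq_zero.1 h5)

namespace IsC2DefiningAt

theorem mem (h : IsC2DefiningAt K φ x) : x ∈ K := h.eventually_mem_iff.self_of_nhds.2 h.eq_zero.le

theorem eventually_differentiableAt (h : IsC2DefiningAt K φ x) :
    ∀ᶠ y in 𝓝 x, DifferentiableAt ℝ φ y :=
  (h.contDiffAt.eventually (by simp)).mono fun _ hy => hy.differentiableAt (by simp)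

theorem contDiffAt_gradient (h : IsC2DefiningAt K φ x) : ContDiffAt ℝ 1 (∇ φ) x := by
  have h1 : ContDiffAt ℝ 1 (fderiv ℝ φ) x := h.contDiffAt.fderiv_right (by norm_num)
  exact ((InnerProductSpace.toDual ℝ (EuclideanSpace ℝ (Fin n))).symm.contDiff.contDiffAt).comp x h1

theorem contDiffAt_levelNormal (h : IsC2DefiningAt K φ x) : ContDiffAt ℝ 1 (levelNormal φ) x :=
  ((h.contDiffAt_gradient.norm ℝ h.gradient_ne_zero).inv
    (norm_ne_zero_iff.2 h.gradient_ne_zero)).smul h.contDiffAt_gradient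

theorem differentiableAt_levelNormal (h : IsC2DefiningAt K φ x) :
    DifferentiableAt ℝ (levelNormal φ) x :=
  h.contDiffAt_levelNormal.differentiableAt (by simp)

theorem eventually_gradient_ne_zero (h : IsC2DefiningAt K φ x) : ∀ᶠ y in 𝓝 x, ∇ φ y ≠ 0 :=
  h.contDiffAt_gradient.continuousAt.eventually_ne h.gradient_ne_zero

theorem inner_levelNormal_fderiv (h : IsC2DefiningAt K φ x) (v : EuclideanSpace ℝ (Fin n)) :
    ⟪levelNormal φ x, fderiv ℝ (levelNormal φ) x v⟫ = 0 := by
  have h1 := h.differentiableAt_levelNormal.hasFDerivAt.norm_sq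
  have h2 : (fun y => ‖levelNormal φ y‖ ^ 2) =ᶠ[𝓝 x] fun _ => (1 : ℝ) := by
    filter_upwards [h.eventually_gradient_ne_zero] with y hy
    rw [norm_levelNormal hy, one_pow]
  have h3 := (h1.congr_of_eventuallyEq h2.symm).unique (hasFDerivAt_const (1 : ℝ) x)
  have h4 := DFunLike.congr_fun h3 v
  simpa using h4

/-- At the points of the zero set close to `x`, the level normal is an outer unit normal. -/
theorem eventually_isOuterUnitNormal (h : IsC2DefiningAt K φ x) (hK : Convex ℝ K) :
    ∀ᶠ y in 𝓝 x, φ y = 0 → y ∈ K ∧ IsOuterUnitNormal K y (levelNormal φ y) := by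
  filter_upwards [h.eventually_differentiableAt, h.eventually_gradient_ne_zero,
    h.eventually_mem_iff.eventually_nhds] with y hy1 hy2 hy3 hy0
  refine ⟨hy3.self_of_nhds.2 hy0.le, norm_levelNormal hy2, fun z hz => ?_⟩
  rw [levelNormal, real_inner_smul_left]
  exact mul_nonpos_of_nonneg_of_nonpos (by positivity) (inner_gradient_nonpos hK hy1 hy0 hy3 hz)

theorem eventually_eq_levelNormal (h : IsC2DefiningAt K φ x) :
    ∀ᶠ y in 𝓝 x, ∀ u, y ∈ K → IsOuterUnitNormal K y u → u = levelNormal φ y := by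
  filter_upwards [h.eventually_differentiableAt, h.eventually_gradient_ne_zero,
    h.eventually_mem_iff.eventually_nhds] with y hy1 hy2 hy3 u hy hu
  exact hu.eq_levelNormal hy1 hy hy2 hy3

theorem isOuterUnitNormal (h : IsC2DefiningAt K φ x) (hK : Convex ℝ K) :
    IsOuterUnitNormal K x (levelNormal φ x) :=
  ((h.eventually_isOuterUnitNormal hK).self_of_nhds h.eq_zero).2

theorem eq_levelNormal (h : IsC2DefiningAt K φ x) (hu : IsOuterUnitNormal K x u) :
    u = levelNormal φ x :=
  h.eventually_eq_levelNormal.self_of_nhds u h.mem hu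

theorem outerUnitNormal_eq (h : IsC2DefiningAt K φ x) (hK : Convex ℝ K) :
    outerUnitNormal K x = levelNormal φ x := by
  have hex : ∃ u, IsOuterUnitNormal K x u := ⟨_, h.isOuterUnitNormal hK⟩
  rw [outerUnitNormal, dif_pos hex]
  exact h.eq_levelNormal hex.choose_spec

/-- Two maps that agree on the zero set of `φ` near `x` have the same tangential derivatives. -/
theorem fderiv_apply_eq_of_eqOn (h : IsC2DefiningAt K φ x)
    {N₁ N₂ : EuclideanSpace ℝ (Fin n) → EuclideanSpace ℝ (Fin n)}
    (h₁ : DifferentiableAt ℝ N₁ x) (h₂ : DifferentiableAt ℝ N₂ x)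
    (heq : ∀ᶠ y in 𝓝 x, φ y = 0 → N₁ y = N₂ y) {ξ : EuclideanSpace ℝ (Fin n)}
    (hξ : ⟪∇ φ x, ξ⟫ = 0) : fderiv ℝ N₁ x ξ = fderiv ℝ N₂ x ξ := by
  have hs : HasStrictFDerivAt φ (fderiv ℝ φ x) x := h.contDiffAt.hasStrictFDerivAt (by simp)
  have hsurj : (fderiv ℝ φ x).range = ⊤ := by
    rw [LinearMap.range_eq_top]
    apply LinearMap.surjective
    intro h0
    apply h.gradient_ne_zero
    have h1 : ⟪∇ φ x, ∇ φ x⟫ = 0 := by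
      rw [inner_gradient_left]; exact LinearMap.congr_fun h0 _
    exact inner_self_eq_zero.1 h1
  -- I parametrizes the zero set by the tangent space, and its derivative at 0 is the inclusion;
  -- hence equality of N₁ ∘ I and N₂ ∘ I gives equality of tangential derivatives.
  set I := hs.implicitFunction φ (fderiv ℝ φ x) hsurj (φ x)
  have hI0 : I 0 = x := hs.implicitFunction_apply_image hsurj
  have hI : HasFDerivAt I ((fderiv ℝ φ x).ker.subtypeL) 0 :=
    (hs.to_implicitFunction hsurj).hasFDerivAt
  have hIc : Tendsto I (𝓝 0) (𝓝 x) := by simpa [hI0] using hI.continuousAt.tendsto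
  have hlev : ∀ᶠ p in 𝓝 (0 : (fderiv ℝ φ x).ker), φ (I p) = 0 := by
    have h1 := hs.map_implicitFunction_eq hsurj
    have h2 : Tendsto (fun p : (fderiv ℝ φ x).ker => (φ x, p)) (𝓝 0) (𝓝 (φ x, 0)) :=
      (Continuous.prodMk_right (φ x)).tendsto 0
    filter_upwards [h2.eventually h1] with p hp
    rw [← h.eq_zero]; exact hp
  have hcomp : N₁ ∘ I =ᶠ[𝓝 0] N₂ ∘ I := by
    filter_upwards [hlev, hIc.eventually heq] with p hp1 hp2
    exact hp2 hp1
  have hd₁ : HasFDerivAt (N₁ ∘ I) ((fderiv ℝ N₁ x) ∘L (fderiv ℝ φ x).ker.subtypeL) 0 :=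
    HasFDerivAt.comp 0 (by rw [hI0]; exact h₁.hasFDerivAt) hI
  have hd₂ : HasFDerivAt (N₂ ∘ I) ((fderiv ℝ N₂ x) ∘L (fderiv ℝ φ x).ker.subtypeL) 0 :=
    HasFDerivAt.comp 0 (by rw [hI0]; exact h₂.hasFDerivAt) hI
  have hu := (hd₁.congr_of_eventuallyEq hcomp.symm).unique hd₂
  have hmem : ξ ∈ (fderiv ℝ φ x).ker := by
    rw [LinearMap.mem_ker, ← hξ, inner_gradient_left]; rfl
  exact DFunLike.congr_fun hu ⟨ξ, hmem⟩

theorem det_weingartenMap (h : IsC2DefiningAt K φ x) : LinearMap.det (weingartenMap φ x) =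
    LinearMap.det (borderedMap (levelNormal φ x) (fderiv ℝ (levelNormal φ) x).toLinearMap) := by
  have hS : levelTangent φ x = (ℝ ∙ levelNormal φ x)ᗮ := by
    rw [levelTangent, levelNormal, Submodule.span_singleton_smul_eq]
    exact (inv_ne_zero (norm_ne_zero_iff.2 h.gradient_ne_zero)).isUnit
  exact det_compression_eq_det_borderedMap (norm_levelNormal h.gradient_ne_zero) _ hS

/-- Independence of the chosen defining function: by uniqueness of the outer unit normal, the normal
fields of two defining functions agree along the boundary, hence so do their tangential derivatives.
-/
theorem gaussCurvature_eq (h : IsC2DefiningAt K φ x) (hK : Convex ℝ K) : gaussCurvature K x =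
    LinearMap.det (borderedMap (levelNormal φ x) (fderiv ℝ (levelNormal φ) x).toLinearMap) := by
  have hex : ∃ φ, IsC2DefiningAt K φ x := ⟨φ, h⟩
  rw [gaussCurvature, dif_pos hex]
  have h' := hex.choose_spec
  set χ := hex.choose
  rw [h'.det_weingartenMap]
  have hN : levelNormal χ x = levelNormal φ x := h.eq_levelNormal (h'.isOuterUnitNormal hK)
  congr 1
  ext1 v
  rw [borderedMap_apply, borderedMap_apply, hN]
  congr 1
  refine h.fderiv_apply_eq_of_eqOn h'.differentiableAt_levelNormal h.differentiableAt_levelNormal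
    ?_ ?_
  · filter_upwards [h.eventually_isOuterUnitNormal hK, h'.eventually_eq_levelNormal]
      with y hy1 hy2 hy0
    exact (hy2 _ (hy1 hy0).1 (hy1 hy0).2).symm
  · rw [gradient_eq_smul_levelNormal h.gradient_ne_zero, real_inner_smul_left, inner_sub_right,
      real_inner_smul_right, inner_self_of_norm_eq_one (norm_levelNormal h.gradient_ne_zero)]
    ring

end IsC2DefiningAt

end Convex

/-! ### The inverse Gauss map and the support function -/

section InverseGauss

open Filter

variable {n : ℕ} {K : Set (EuclideanSpace ℝ (Fin n))} {φ : EuclideanSpace ℝ (Fin n) → ℝ}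
  {x u₀ : EuclideanSpace ℝ (Fin n)} {X : EuclideanSpace ℝ (Fin n) → EuclideanSpace ℝ (Fin n)}

theorem hasFDerivAt_inv_norm_smul {V : Type*} [NormedAddCommGroup V] [InnerProductSpace ℝ V]
    {u₀ ν : V} (hu : u₀ ≠ 0) (hν : u₀ = ‖u₀‖ • ν) :
    HasFDerivAt (fun u : V => ‖u‖⁻¹ • u)
      (‖u₀‖⁻¹ • (ContinuousLinearMap.id ℝ V - (innerSL ℝ ν).smulRight ν)) u₀ := by
  have hpos : 0 < ‖u₀‖ := norm_pos_iff.2 hu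
  have h1 : HasFDerivAt (fun u : V => ‖u‖ ^ 2) (2 • (innerSL ℝ u₀)) u₀ :=
    (hasStrictFDerivAt_norm_sq u₀).hasFDerivAt
  have h2 : HasFDerivAt (fun u : V => ‖u‖) ((1 / (2 * √(‖u₀‖ ^ 2))) • (2 • (innerSL ℝ u₀))) u₀ := by
    have := h1.sqrt (by positivity)
    simpa only [Real.sqrt_sq (norm_nonneg _)] using this
  have h3 := ((hasDerivAt_inv hpos.ne').comp_hasFDerivAt u₀ h2).smul (hasFDerivAt_id u₀)
  refine h3.congr_fderiv ?_
  ext1 v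
  rw [Real.sqrt_sq hpos.le]
  have hin : ⟪u₀, v⟫ = ‖u₀‖ * ⟪ν, v⟫ := by
    conv_lhs => rw [hν, real_inner_smul_left]
  simp only [Function.comp_apply, id, add_apply, smul_apply,
    ContinuousLinearMap.smulRight_apply, sub_apply,
    ContinuousLinearMap.id_apply, innerSL_apply_apply, hin, smul_eq_mul, nsmul_eq_mul]
  have h4 : ∀ a : ℝ, a • u₀ = (a * ‖u₀‖) • ν := fun a => by
    conv_lhs => rw [hν, smul_smul]
  rw [h4]
  match_scalars <;> field_simp

/-- The inverse of the Gauss map near a boundary point with nonvanishing curvature, as a function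
of not necessarily normalized normal vectors. -/
theorem IsC2DefiningAt.exists_inverse_gauss (h : IsC2DefiningAt K φ x) (hK : Convex ℝ K)
    (hdet : gaussCurvature K x ≠ 0) (hu : u₀ ≠ 0) (hν : u₀ = ‖u₀‖ • levelNormal φ x) :
    ∃ X : EuclideanSpace ℝ (Fin n) → EuclideanSpace ℝ (Fin n), ContDiffAt ℝ 1 X u₀ ∧ X u₀ = x ∧
      (∀ᶠ u in 𝓝 u₀, X u ∈ K ∧ ∀ z ∈ K, ⟪u, z - X u⟫ ≤ 0) ∧
      (∀ v, ⟪levelNormal φ x, fderiv ℝ X u₀ v⟫ = 0) ∧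
      ∀ v, fderiv ℝ (levelNormal φ) x (fderiv ℝ X u₀ v) =
        ‖u₀‖⁻¹ • (v - ⟪levelNormal φ x, v⟫ • levelNormal φ x) := by
  rw [h.gaussCurvature_eq hK] at hdet
  set ν := levelNormal φ x with hνdef
  set A := fderiv ℝ (levelNormal φ) x with hA
  have hν1 : ‖ν‖ = 1 := norm_levelNormal h.gradient_ne_zero
  have hνν := inner_self_of_norm_eq_one hν1
  have hpos : 0 < ‖u₀‖ := norm_pos_iff.2 hu
  have hφd : HasFDerivAt φ (fderiv ℝ φ x) x := (h.contDiffAt.differentiableAt (by simp)).hasFDerivAt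
  have hNd : HasFDerivAt (levelNormal φ) A x := h.differentiableAt_levelNormal.hasFDerivAt
  -- G extends the Gauss map off the hypersurface: φ is recorded as the length along the normal.
  -- Nonzero curvature makes its derivative invertible, so the inverse function theorem applies in
  -- the full space.
  set G : EuclideanSpace ℝ (Fin n) → EuclideanSpace ℝ (Fin n) :=
    fun z => (1 + φ z) • levelNormal φ z with hG
  have hGc : ContDiffAt ℝ 1 G x :=
    (contDiffAt_const.add (h.contDiffAt.of_le (by norm_num))).smul h.contDiffAt_levelNormal
  set G' : EuclideanSpace ℝ (Fin n) →L[ℝ] EuclideanSpace ℝ (Fin n) :=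
    A + (fderiv ℝ φ x).smulRight ν with hG'
  have hGd : HasFDerivAt G G' x := by
    have := (hφd.const_add 1).smul hNd
    simp only [h.eq_zero, add_zero, one_smul] at this
    exact this
  have hinj : Function.Injective G' := by
    rw [injective_iff_map_eq_zero]
    intro ξ hξ
    have h1 : A ξ + fderiv ℝ φ x ξ • ν = 0 := hξ
    have h2 := congrArg (fun w => ⟪ν, w⟫) h1
    simp only [inner_add_right, real_inner_smul_right, hνν, inner_zero_right, mul_one] at h2
    rw [h.inner_levelNormal_fderiv ξ, zero_add] at h2
    have h3 : ⟪ν, ξ⟫ = 0 := by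
      rw [← inner_gradient_left, gradient_eq_smul_levelNormal h.gradient_ne_zero,
        real_inner_smul_left] at h2
      exact (mul_eq_zero.1 h2).resolve_left (norm_ne_zero_iff.2 h.gradient_ne_zero)
    rw [h2, zero_smul, add_zero] at h1
    refine (LinearMap.equivOfDetNeZero _ hdet).injective ?_
    rw [map_zero]
    change borderedMap ν A.toLinearMap ξ = 0
    rw [borderedMap_apply, h3, zero_smul, sub_zero, add_zero]
    exact h1
  set e : EuclideanSpace ℝ (Fin n) ≃L[ℝ] EuclideanSpace ℝ (Fin n) :=
    (LinearEquiv.ofInjectiveEndo G'.toLinearMap hinj).toContinuousLinearEquiv with he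
  have hGe : HasFDerivAt G (e : EuclideanSpace ℝ (Fin n) →L[ℝ] EuclideanSpace ℝ (Fin n)) x := by
    convert hGd using 1
    ext v
    rfl
  have hGx : G x = ν := by simp [hG, h.eq_zero, hνdef]
  set g := hGc.localInverse hGe one_ne_zero with hg
  have hgc : ContDiffAt ℝ 1 g ν := hGx ▸ hGc.to_localInverse hGe one_ne_zero
  have hgx : g ν = x := by
    conv_lhs => rw [← hGx]
    exact hGc.localInverse_apply_image hGe one_ne_zero
  have hright : ∀ᶠ w in 𝓝 ν, G (g w) = w := by
    have := (hGc.hasStrictFDerivAt' hGe one_ne_zero).eventually_right_inverse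
    rwa [hGx] at this
  have hnrm := hasFDerivAt_inv_norm_smul hu hν
  have hnrm0 : ‖u₀‖⁻¹ • u₀ = ν := by
    conv_lhs => rw [hν, norm_smul, hν1]
    rw [norm_norm, mul_one, smul_smul, inv_mul_cancel₀ hpos.ne', one_smul]
  have hnc : ContDiffAt ℝ 1 (fun u : EuclideanSpace ℝ (Fin n) => ‖u‖⁻¹ • u) u₀ :=
    ((contDiffAt_norm ℝ hu).inv hpos.ne').smul contDiffAt_id
  set X : EuclideanSpace ℝ (Fin n) → EuclideanSpace ℝ (Fin n) := fun u => g (‖u‖⁻¹ • u) with hX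
  have hXc : ContDiffAt ℝ 1 X u₀ := ContDiffAt.comp u₀ (g := g) (by rw [hnrm0]; exact hgc) hnc
  have hX0 : X u₀ = x := by simp only [hX, hnrm0, hgx]
  have hXt : Tendsto X (𝓝 u₀) (𝓝 x) := by simpa [hX0] using hXc.continuousAt.tendsto
  have hnt : Tendsto (fun u : EuclideanSpace ℝ (Fin n) => ‖u‖⁻¹ • u) (𝓝 u₀) (𝓝 ν) := by
    have := hnc.continuousAt.tendsto
    rwa [hnrm0] at this
  have hXd : HasFDerivAt X (fderiv ℝ X u₀) u₀ := (hXc.differentiableAt one_ne_zero).hasFDerivAt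
  have hφsmall : ∀ᶠ y in 𝓝 x, -1 < φ y :=
    h.contDiffAt.continuousAt.eventually (Ioi_mem_nhds (by rw [h.eq_zero]; norm_num))
  -- G (X u) is a unit vector, so |1 + φ (X u)| = 1; as φ > -1 near x, this forces φ (X u) = 0.
  have hkey : ∀ᶠ u in 𝓝 u₀, u ≠ 0 ∧ φ (X u) = 0 ∧ levelNormal φ (X u) = ‖u‖⁻¹ • u := by
    filter_upwards [hnt.eventually hright, hXt.eventually hφsmall,
      hXt.eventually h.eventually_gradient_ne_zero, eventually_ne_nhds hu] with u h1 h2 h3 h4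
    have h5 : (1 + φ (X u)) • levelNormal φ (X u) = ‖u‖⁻¹ • u := h1
    have h6 : |1 + φ (X u)| = 1 := by
      have := congrArg norm h5
      rwa [norm_smul, norm_levelNormal h3, norm_smul, norm_inv, norm_norm,
        inv_mul_cancel₀ (norm_ne_zero_iff.2 h4), mul_one, Real.norm_eq_abs] at this
    rw [abs_of_pos (by linarith)] at h6
    have h7 : φ (X u) = 0 := by linarith
    refine ⟨h4, h7, ?_⟩
    rw [← h5, h7, add_zero, one_smul]
  refine ⟨X, hXc, hX0, ?_, ?_, ?_⟩
  · filter_upwards [hkey, hXt.eventually (h.eventually_isOuterUnitNormal hK)] with u h1 h2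
    obtain ⟨h3, h4⟩ := h2 h1.2.1
    refine ⟨h3, fun z hz => ?_⟩
    have h5 := h4.2 z hz
    rw [h1.2.2, real_inner_smul_left] at h5
    exact nonpos_of_mul_nonpos_right h5 (inv_pos.2 (norm_pos_iff.2 h1.1))
  · intro v
    have h1 : HasFDerivAt (fun u => φ (X u)) ((fderiv ℝ φ x) ∘L fderiv ℝ X u₀) u₀ :=
      HasFDerivAt.comp u₀ (g := φ) (by rw [hX0]; exact hφd) hXd
    have h2 : (fun u => φ (X u)) =ᶠ[𝓝 u₀] fun _ => (0 : ℝ) := hkey.mono fun u hu => hu.2.1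
    have h3 := DFunLike.congr_fun ((h1.congr_of_eventuallyEq h2.symm).unique
      (hasFDerivAt_const (0 : ℝ) u₀)) v
    have h4 : fderiv ℝ φ x (fderiv ℝ X u₀ v) = 0 := h3
    rw [← inner_gradient_left, gradient_eq_smul_levelNormal h.gradient_ne_zero,
        real_inner_smul_left] at h4
    exact (mul_eq_zero.1 h4).resolve_left (norm_ne_zero_iff.2 h.gradient_ne_zero)
  · intro v
    have h1 : HasFDerivAt (fun u => levelNormal φ (X u)) (A ∘L fderiv ℝ X u₀) u₀ :=
      HasFDerivAt.comp u₀ (g := levelNormal φ) (by rw [hX0]; exact hNd) hXd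
    have h2 : (fun u => levelNormal φ (X u)) =ᶠ[𝓝 u₀] fun u => ‖u‖⁻¹ • u :=
      hkey.mono fun u hu => hu.2.2
    have h3 := DFunLike.congr_fun ((h1.congr_of_eventuallyEq h2.symm).unique hnrm) v
    exact h3

/-- If `X u` maximizes `⟪u, ·⟫` over `K` for all `u` near `u₀`, then the support function of `K`
has the gradient `X`. -/
theorem eventually_hasGradientAt_support (hX : ContDiffAt ℝ 1 X u₀)
    (hmax : ∀ᶠ u in 𝓝 u₀, X u ∈ K ∧ ∀ z ∈ K, ⟪u, z - X u⟫ ≤ 0) (c : ℝ) :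
    ∀ᶠ u in 𝓝 u₀, HasGradientAt (fun u => ⟪X u, u⟫ + c) (X u) u := by
  filter_upwards [hmax.eventually_nhds, hX.eventually (by simp)] with u hu hc
  rw [hasGradientAt_iff_isLittleO, Asymptotics.isLittleO_iff]
  intro ε hε
  have hclose : ∀ᶠ v in 𝓝 u, ‖X v - X u‖ < ε := by
    have := (hc.continuousAt.sub (continuousAt_const (y := X u))).norm
    exact this.eventually (Iio_mem_nhds (by simpa using hε))
  filter_upwards [hu, hclose] with v hv hvε
  have hu0 := hu.self_of_nhds
  -- Maximality at u and at v squeezes the first-order remainder between 0 and ⟨X v - X u, v - u⟩,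
  -- so continuity of X suffices.
  have h1 := hv.2 _ hu0.1
  have h2 := hu0.2 _ hv.1
  have h3 := real_inner_le_norm (X v - X u) (v - u)
  have h4 : ‖X v - X u‖ * ‖v - u‖ ≤ ε * ‖v - u‖ := by gcongr
  have e1 := real_inner_comm (X u) v
  have e2 := real_inner_comm (X v) v
  have e3 := real_inner_comm (X u) u
  have e4 := real_inner_comm (X v) u
  simp only [inner_sub_right, inner_sub_left] at h1 h2 h3 ⊢
  rw [Real.norm_eq_abs, abs_le]
  constructor
  · have : 0 ≤ ε * ‖v - u‖ := by positivity
    linarith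
  · linarith

/-- The gradient is X itself, which is of class C¹; this gains the order that the formula ⟨X u, u⟩
does not show. -/
theorem contDiffAt_support (hX : ContDiffAt ℝ 1 X u₀)
    (hmax : ∀ᶠ u in 𝓝 u₀, X u ∈ K ∧ ∀ z ∈ K, ⟪u, z - X u⟫ ≤ 0) (c : ℝ) :
    ContDiffAt ℝ 2 (fun u => ⟪X u, u⟫ + c) u₀ := by
  rw [show (2 : WithTop ℕ∞) = ((1 : ℕ) : WithTop ℕ∞) + 1 by norm_num,
    contDiffAt_succ_iff_hasFDerivAt]
  refine ⟨fun u => InnerProductSpace.toDual ℝ _ (X u),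
    ⟨_, eventually_hasGradientAt_support hX hmax c, fun u hu => ?_⟩, ?_⟩
  · exact HasGradientAt.hasFDerivAt hu
  · exact (InnerProductSpace.toDual ℝ (EuclideanSpace ℝ (Fin n))).contDiff.contDiffAt.comp u₀ hX

/-- The differential of X is the Hessian of the support function. -/
theorem isSymmetric_fderiv_of_maximizer (hX : ContDiffAt ℝ 1 X u₀)
    (hmax : ∀ᶠ u in 𝓝 u₀, X u ∈ K ∧ ∀ z ∈ K, ⟪u, z - X u⟫ ≤ 0) :
    (fderiv ℝ X u₀).toLinearMap.IsSymmetric := by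
  intro v w
  have h1 := eventually_hasGradientAt_support hX hmax 0
  have h2 : HasFDerivAt (fun u => innerSL ℝ (X u)) ((innerSL ℝ) ∘L fderiv ℝ X u₀) u₀ :=
    (innerSL ℝ (E := EuclideanSpace ℝ (Fin n))).hasFDerivAt.comp u₀
      (hX.differentiableAt one_ne_zero).hasFDerivAt
  have h3 := second_derivative_symmetric_of_eventually (𝕜 := ℝ)
    (h1.mono fun u hu => HasGradientAt.hasFDerivAt hu) h2 v w
  have h4 : ⟪fderiv ℝ X u₀ v, w⟫ = ⟪fderiv ℝ X u₀ w, v⟫ := h3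
  rw [real_inner_comm v] at h4
  exact h4

end InverseGauss

/-! ### Curvature and equiaffine support function under copolarity -/

section Duality

open Filter

/-- The compression does not see components along g. This discards the normal component that appears
when X/‖X‖ is differentiated. -/
theorem det_borderedMap_congr {V : Type*} [NormedAddCommGroup V] [InnerProductSpace ℝ V]
    [FiniteDimensional ℝ V] {g : V} (hg : ‖g‖ = 1) {A B : V →ₗ[ℝ] V}
    (h : ∀ v, B v - A v ∈ ℝ ∙ g) :
    LinearMap.det (borderedMap g B) = LinearMap.det (borderedMap g A) := by
  rw [← det_compression_eq_det_borderedMap hg B rfl, ← det_compression_eq_det_borderedMap hg A rfl]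
  congr 1
  ext1 v
  rw [← sub_eq_zero]
  simp only [compression, LinearMap.comp_apply, Submodule.subtype_apply]
  rw [← map_sub]
  refine Submodule.orthogonalProjectionOnto_apply_of_mem_orthogonal ?_
  rw [Submodule.orthogonal_orthogonal]
  exact h v

variable {n : ℕ} {K : Set (EuclideanSpace ℝ (Fin n))} {φ : EuclideanSpace ℝ (Fin n) → ℝ}
  {x u : EuclideanSpace ℝ (Fin n)}

theorem convex_copolar : Convex ℝ (copolar K) := by
  intro u hu v hv a b ha hb hab x hx
  rw [inner_add_left, real_inner_smul_left, real_inner_smul_left]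
  have h1 := mul_le_mul_of_nonneg_left (hu x hx) ha
  have h2 := mul_le_mul_of_nonneg_left (hv x hx) hb
  nlinarith

/-- The function ψ is the support function of K plus 1, with gradient X, equal to x at u. In the
determinant identity k = 1/|x|, d = 1/|u| and ⟨ν, μ⟩ = -kd, so the exponent is (n - 1) + 2 = n + 1.
-/
theorem IsC2DefiningAt.exists_copolar (h : IsC2DefiningAt K φ x) (hK : Convex ℝ K)
    (hκ : gaussCurvature K x ≠ 0) (hu : u = ‖u‖ • levelNormal φ x) (hux : ⟪u, x⟫ = -1) :
    ∃ ψ, IsC2DefiningAt (copolar K) ψ u ∧ levelNormal ψ u = ‖x‖⁻¹ • x ∧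
      gaussCurvature K x * gaussCurvature (copolar K) u = (‖x‖⁻¹ * ‖u‖⁻¹) ^ (n + 1) := by
  have hu0 : u ≠ 0 := by rintro rfl; simp at hux
  have hx0 : x ≠ 0 := by rintro rfl; simp at hux
  have hupos : 0 < ‖u‖ := norm_pos_iff.2 hu0
  have hxpos : 0 < ‖x‖ := norm_pos_iff.2 hx0
  obtain ⟨X, hXc, hXu, hmax, hD, hAD⟩ := h.exists_inverse_gauss hK hκ hu0 hu
  set ν := levelNormal φ x with hν
  have hν1 : ‖ν‖ = 1 := norm_levelNormal h.gradient_ne_zero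
  set ψ : EuclideanSpace ℝ (Fin n) → ℝ := fun u => ⟪X u, u⟫ + 1 with hψ
  have hgrad : ∀ᶠ w in 𝓝 u, ∇ ψ w = X w :=
    (eventually_hasGradientAt_support hXc hmax 1).mono fun w hw => hw.gradient
  have hgrad0 : ∇ ψ u = x := by rw [hgrad.self_of_nhds, hXu]
  have hdef : IsC2DefiningAt (copolar K) ψ u :=
    { contDiffAt := contDiffAt_support hXc hmax 1
      eq_zero := by simp only [hψ, hXu]; rw [real_inner_comm, hux]; norm_num
      gradient_ne_zero := by rwa [hgrad0]
      eventually_mem_iff := by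
        filter_upwards [hmax] with w hw
        simp only [hψ, copolar, Set.mem_ofPred_eq]
        rw [real_inner_comm]
        constructor
        · intro h1
          linarith [h1 _ hw.1]
        · intro h1 z hz
          have h2 := hw.2 z hz
          rw [inner_sub_right] at h2
          linarith }
  set μ := ‖x‖⁻¹ • x with hμ
  have hψN : levelNormal ψ u = μ := by rw [levelNormal, hgrad0]
  have hμ1 : ‖μ‖ = 1 := hψN ▸ norm_levelNormal hdef.gradient_ne_zero
  refine ⟨ψ, hdef, hψN, ?_⟩
  have hxμ : x = ‖x‖ • μ := by rw [hμ, smul_smul, mul_inv_cancel₀ hxpos.ne', one_smul]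
  have hXd : HasFDerivAt X (fderiv ℝ X u) u := (hXc.differentiableAt one_ne_zero).hasFDerivAt
  have hNd : HasFDerivAt (levelNormal ψ) ((‖x‖⁻¹ •
      (ContinuousLinearMap.id ℝ _ - (innerSL ℝ μ).smulRight μ)) ∘L fderiv ℝ X u) u := by
    have h1 := HasFDerivAt.comp u (g := fun w : EuclideanSpace ℝ (Fin n) => ‖w‖⁻¹ • w)
      (by rw [hXu]; exact hasFDerivAt_inv_norm_smul hx0 hxμ) hXd
    refine h1.congr_of_eventuallyEq ?_
    filter_upwards [hgrad] with w hw
    rw [levelNormal, hw]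
    rfl
  have hκ' : gaussCurvature (copolar K) u =
      LinearMap.det (borderedMap μ (‖x‖⁻¹ • (fderiv ℝ X u).toLinearMap)) := by
    rw [hdef.gaussCurvature_eq convex_copolar, hψN, hNd.fderiv]
    refine det_borderedMap_congr hμ1 fun v => Submodule.mem_span_singleton.2
      ⟨-(‖x‖⁻¹ * ⟪μ, fderiv ℝ X u v⟫), ?_⟩
    simp only [ContinuousLinearMap.coe_coe, ContinuousLinearMap.comp_apply,
      smul_apply, sub_apply, ContinuousLinearMap.id_apply,
      ContinuousLinearMap.smulRight_apply, innerSL_apply_apply, LinearMap.smul_apply]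
    module
  have hc : ⟪ν, μ⟫ = -(‖x‖⁻¹ * ‖u‖⁻¹) := by
    have h1 : ‖u‖ * ⟪ν, x⟫ = -1 := by rw [← real_inner_smul_left, ← hu, hux]
    rw [hμ, real_inner_smul_right]
    field_simp
    linarith
  have hkd : ‖x‖⁻¹ * ‖u‖⁻¹ ≠ 0 := by positivity
  have hdet := det_borderedMap_mul_det_borderedMap (k := ‖x‖⁻¹) (d := ‖u‖⁻¹)
    (A := (fderiv ℝ (levelNormal φ) x).toLinearMap) (D := (fderiv ℝ X u).toLinearMap)
    hν1 hμ1 h.inner_levelNormal_fderiv hD hAD hkd (by rw [hc]; exact neg_ne_zero.2 hkd)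
  rw [← hκ', ← h.gaussCurvature_eq hK, hc, finrank_euclideanSpace_fin, neg_sq] at hdet
  apply mul_left_cancel₀ hkd
  rw [hdet]
  ring

theorem IsC2DefiningAt.equiaffineSupport_copolar (h : IsC2DefiningAt K φ x) (hK : Convex ℝ K)
    (hκ : 0 < gaussCurvature K x) (hu : u = ‖u‖ • levelNormal φ x) (hux : ⟪u, x⟫ = -1) :
    (∃ ψ, IsC2DefiningAt (copolar K) ψ u) ∧ 0 < gaussCurvature (copolar K) u ∧
      equiaffineSupport (copolar K) u = (equiaffineSupport K x)⁻¹ := by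
  obtain ⟨ψ, hψ, hψN, hprod⟩ := h.exists_copolar hK hκ.ne' hu hux
  have hupos : 0 < ‖u‖ := norm_pos_iff.2 (by rintro rfl; simp at hux)
  have hxpos : 0 < ‖x‖ := norm_pos_iff.2 (by rintro rfl; simp at hux)
  have hκ' : 0 < gaussCurvature (copolar K) u :=
    pos_of_mul_pos_right (hprod ▸ by positivity) hκ.le
  refine ⟨⟨ψ, hψ⟩, hκ', ?_⟩
  rw [equiaffineSupport, equiaffineSupport, h.outerUnitNormal_eq hK,
    hψ.outerUnitNormal_eq convex_copolar, hψN, real_inner_smul_right, hux]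
  have h1 : ⟪x, levelNormal φ x⟫ = -‖u‖⁻¹ := by
    have h1 : ‖u‖ * ⟪levelNormal φ x, x⟫ = -1 := by rw [← real_inner_smul_left, ← hu, hux]
    rw [real_inner_comm]
    field_simp
    linarith
  rw [h1]
  have h2 : gaussCurvature K x ^ (1 / ((n : ℝ) + 1)) *
      gaussCurvature (copolar K) u ^ (1 / ((n : ℝ) + 1)) = ‖x‖⁻¹ * ‖u‖⁻¹ := by
    rw [← Real.mul_rpow hκ.le hκ'.le, hprod, ← Real.rpow_natCast, ← Real.rpow_mul (by positivity)]
    have : ((n + 1 : ℕ) : ℝ) * (1 / ((n : ℝ) + 1)) = 1 := by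
      push_cast; field_simp
    rw [this, Real.rpow_one]
  have h3 : 0 < gaussCurvature K x ^ (1 / ((n : ℝ) + 1)) := Real.rpow_pos_of_pos hκ _
  have h4 : 0 < gaussCurvature (copolar K) u ^ (1 / ((n : ℝ) + 1)) := Real.rpow_pos_of_pos hκ' _
  field_simp at h2 ⊢
  linarith

/-- A point of `K` at which a nonzero linear functional is maximal is a boundary point. -/
theorem mem_frontier_of_maximizer (hx : x ∈ K) (hu : u ≠ 0) (hmax : ∀ z ∈ K, ⟪u, z - x⟫ ≤ 0) :
    x ∈ frontier K := by
  refine ⟨subset_closure hx, fun hint => ?_⟩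
  have h1 := (tendsto_line x u).eventually (mem_interior_iff_mem_nhds.1 hint)
  obtain ⟨t, ht, ht0⟩ := (h1.and (eventually_mem_nhdsWithin (a := (0 : ℝ)) (s := Set.Ioi 0))).exists
  have h2 := hmax _ ht
  rw [add_sub_cancel_left, real_inner_smul_right] at h2
  have h3 : 0 < ⟪u, u⟫ := real_inner_self_pos.2 hu
  exact absurd h2 (not_le.2 (mul_pos ht0 h3))

theorem HasC2PlusBoundary.exists_defining_of_maximizer (hC2 : HasC2PlusBoundary K)
    (hx : x ∈ K) (hu : u ≠ 0) (hmax : ∀ z ∈ K, ⟪u, z - x⟫ ≤ 0) :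
    ∃ φ, IsC2DefiningAt K φ x ∧ 0 < gaussCurvature K x ∧ u = ‖u‖ • levelNormal φ x := by
  obtain ⟨⟨φ, hφ⟩, hκ⟩ := hC2 x (mem_frontier_of_maximizer hx hu hmax)
  have hpos : 0 < ‖u‖ := norm_pos_iff.2 hu
  have hN : IsOuterUnitNormal K x (‖u‖⁻¹ • u) := by
    refine ⟨?_, fun z hz => ?_⟩
    · rw [norm_smul, norm_inv, norm_norm, inv_mul_cancel₀ hpos.ne']
    · rw [real_inner_smul_left]
      exact mul_nonpos_of_nonneg_of_nonpos (by positivity) (hmax z hz)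
  refine ⟨φ, hφ, hκ, ?_⟩
  rw [← hφ.eq_levelNormal hN, smul_smul, mul_inv_cancel₀ hpos.ne', one_smul]

end Duality

/-! ### Pseudo-cones and their recession cones -/

section PseudoCone

variable {n : ℕ} {K : Set (EuclideanSpace ℝ (Fin n))} {x u y : EuclideanSpace ℝ (Fin n)}

/-- The point z + t x is the dilate by 1 + t of a convex combination of z and x. -/
theorem IsPseudoCone.mem_recessionCone (hK : IsPseudoCone K) (hx : x ∈ K) :
    x ∈ recessionCone K := by
  intro z hz t ht
  have h1 : (1 + t)⁻¹ • z + (t / (1 + t)) • x ∈ K :=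
    hK.convex hz hx (by positivity) (by positivity) (by field_simp)
  have h2 := hK.smul_mem (1 + t) (by linarith) _ h1
  have h3 : (1 + t) ≠ 0 := by positivity
  rwa [smul_add, smul_smul, smul_smul, mul_inv_cancel₀ h3, one_smul, mul_div_cancel₀ _ h3] at h2

theorem inner_nonpos_of_mem_recessionCone (hK : K.Nonempty) {b : ℝ} (hu : ∀ z ∈ K, ⟪u, z⟫ ≤ b)
    (hy : y ∈ recessionCone K) : ⟪u, y⟫ ≤ 0 := by
  obtain ⟨z, hz⟩ := hK
  by_contra! hpos
  have h1 := hu _ (hy z hz ((|b| + |⟪u, z⟫| + 1) / ⟪u, y⟫) (by positivity))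
  rw [inner_add_right, real_inner_smul_right, div_mul_cancel₀ _ hpos.ne'] at h1
  linarith [le_abs_self b, neg_abs_le ⟪u, z⟫]

end PseudoCone

/-! ### Lower bounds for the Hessian of the support function -/

section Asymptotic

open Filter

/-- A lower bound for the determinant of the Hessian of a homogeneous function, in terms of a
lower bound for the Hessian on a hyperplane `⟪e, ·⟫ = 0` transversal to the kernel. -/
theorem le_det_borderedMap {V : Type*} [NormedAddCommGroup V] [InnerProductSpace ℝ V]
    [FiniteDimensional ℝ V] {ν w e y : V} {D : V →ₗ[ℝ] V} {ε β m : ℝ} (hD : D.IsSymmetric)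
    (hw : w = ‖w‖ • ν) (hwe : ⟪w, e⟫ = -1) (hDν : D ν = 0)
    (hε : 0 ≤ ε) (hε1 : ε ≤ 1) (hβ : 0 ≤ β) (hm : 0 < m) (hmy : m ≤ ‖y + ⟪y, w⟫ • e‖)
    (hlow : ∀ ξ, ⟪ξ, e⟫ = 0 → ε * ‖ξ‖ ^ 2 + β * ⟪y, ξ⟫ ^ 2 ≤ ⟪D ξ, ξ⟫) :
    ε ^ (Module.finrank ℝ V - 1) * (β * m ^ 2) ≤ LinearMap.det (borderedMap ν D) := by
  have hDw : D w = 0 := by rw [hw, map_smul, hDν, smul_zero]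
  have happ : ∀ v, borderedMap ν D v = D v + ⟪ν, v⟫ • ν := fun v => by
    rw [borderedMap_apply, map_sub, map_smul, hDν, smul_zero, sub_zero]
  have hsymm : (borderedMap ν D).IsSymmetric := by
    intro a b
    rw [happ, happ, inner_add_left, inner_add_right, hD a b, real_inner_smul_left,
      real_inner_smul_right, real_inner_comm ν a]
    ring
  have hform : ∀ v, ⟪borderedMap ν D v, v⟫ = ⟪D v, v⟫ + ⟪ν, v⟫ ^ 2 := fun v => by
    rw [happ, inner_add_left, real_inner_smul_left]; ring
  have hshift : ∀ v (a : ℝ), ⟪D (v + a • w), v + a • w⟫ = ⟪D v, v⟫ := fun v a => by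
    rw [map_add, map_smul, hDw, smul_zero, add_zero, inner_add_right, real_inner_smul_right,
      hD v w, hDw, inner_zero_right, mul_zero, add_zero]
  have hperp : ∀ v, ⟪v + ⟪v, e⟫ • w, e⟫ = 0 := fun v => by
    rw [inner_add_left, real_inner_smul_left, hwe]; ring
  -- Since D is symmetric and kills w, its quadratic form is unchanged by moving v along w into the
  -- hyperplane orthogonal to e.
  have hbound : ∀ v, ε * ‖v + ⟪v, e⟫ • w‖ ^ 2 + β * ⟪y, v + ⟪v, e⟫ • w⟫ ^ 2 ≤ ⟪D v, v⟫ :=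
    fun v => hshift v ⟪v, e⟫ ▸ hlow _ (hperp v)
  have hz0 : y + ⟪y, w⟫ • e ≠ 0 := norm_pos_iff.1 (hm.trans_le hmy)
  refine hsymm.le_det hε (by positivity) (fun v => ?_) hz0 ?_
  · have h1 := hbound v
    have h2 : ‖v‖ ^ 2 - ⟪ν, v⟫ ^ 2 ≤ ‖v + ⟪v, e⟫ • w‖ ^ 2 := by
      have hvw : ⟪v, w⟫ = ‖w‖ * ⟪ν, v⟫ := by
        conv_lhs => rw [hw, real_inner_smul_right, real_inner_comm]
      rw [norm_add_sq_real, real_inner_smul_right, hvw, norm_smul, mul_pow, Real.norm_eq_abs,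
        sq_abs]
      nlinarith [sq_nonneg (⟪ν, v⟫ + ⟪v, e⟫ * ‖w‖)]
    have h3 : 0 ≤ β * ⟪y, v + ⟪v, e⟫ • w⟫ ^ 2 := by positivity
    have h4 := mul_le_mul_of_nonneg_left h2 hε
    have h5 := mul_le_mul_of_nonneg_right hε1 (sq_nonneg ⟪ν, v⟫)
    rw [hform]
    nlinarith
  -- This z represents the functional v ↦ ⟨y, v + ⟨v, e⟩w⟩, so the β term at z equals β‖z‖⁴.
  · set z := y + ⟪y, w⟫ • e with hz
    have h1 := hbound z
    have h2 : ⟪y, z + ⟪z, e⟫ • w⟫ = ‖z‖ ^ 2 := by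
      rw [← real_inner_self_eq_norm_sq, inner_add_right, real_inner_smul_right]
      conv_rhs => rw [hz, inner_add_left, real_inner_smul_left, ← hz]
      rw [real_inner_comm e z]
      ring
    rw [h2] at h1
    have h3 : m ^ 2 ≤ ‖z‖ ^ 2 := pow_le_pow_left₀ hm.le hmy 2
    have h4 : β * m ^ 2 * ‖z‖ ^ 2 ≤ β * (‖z‖ ^ 2) ^ 2 := by
      rw [sq (‖z‖ ^ 2), ← mul_assoc]
      gcongr
    have h5 : 0 ≤ ε * ‖z + ⟪z, e⟫ • w‖ ^ 2 := by positivity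
    rw [hform]
    nlinarith [sq_nonneg ⟪ν, z⟫]

variable {n : ℕ} {K : Set (EuclideanSpace ℝ (Fin n))}

/-- If the support function of `K` grows at least quadratically from its tangent at `w` in the
direction `ξ`, then the derivative of the inverse Gauss map is bounded from below. -/
theorem le_inner_fderiv_of_growth {X : EuclideanSpace ℝ (Fin n) → EuclideanSpace ℝ (Fin n)}
    {w ξ : EuclideanSpace ℝ (Fin n)} {q : ℝ} (hX : DifferentiableAt ℝ X w)
    (hmax : ∀ᶠ u in 𝓝 w, X u ∈ K ∧ ∀ z ∈ K, ⟪u, z - X u⟫ ≤ 0)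
    (hgrow : ∀ᶠ t : ℝ in 𝓝[>] 0, ⟪w + t • ξ, X w⟫ + t ^ 2 * q ≤ ⟪w + t • ξ, X (w + t • ξ)⟫) :
    q ≤ ⟪fderiv ℝ X w ξ, ξ⟫ := by
  have h1 : HasDerivAt (fun t : ℝ => w + t • ξ) ξ 0 := by
    simpa using ((hasDerivAt_id (0 : ℝ)).smul_const ξ).const_add w
  have h2 : HasFDerivAt X (fderiv ℝ X w) (w + (0 : ℝ) • ξ) := by simpa using hX.hasFDerivAt
  have h3 := h2.comp_hasDerivAt (0 : ℝ) h1
  have h4 := (h3.inner ℝ (hasDerivAt_const (0 : ℝ) ξ)).tendsto_slope_zero_right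
  simp only [inner_zero_right, zero_add, Function.comp_apply, zero_smul, add_zero] at h4
  refine ge_of_tendsto h4 ?_
  filter_upwards [hgrow, (tendsto_line w ξ).eventually hmax, self_mem_nhdsWithin] with t ht hm ht0
  have hpos : (0 : ℝ) < t := ht0
  -- Maximality of X w in direction w leaves t⟨ξ, X(w + tξ) - X w⟩ ≥ t²q, a bound on the difference
  -- quotient of X; no second-order expansion is needed.
  have h5 := hmax.self_of_nhds.2 _ hm.1
  rw [inner_sub_right] at h5
  rw [inner_add_left, inner_add_left, real_inner_smul_left, real_inner_smul_left] at ht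
  rw [smul_eq_mul, real_inner_comm ξ, real_inner_comm ξ]
  rw [inv_mul_eq_div, le_div_iff₀ hpos]
  have h6 : t * (q * t) ≤ t * (⟪ξ, X (w + t • ξ)⟫ - ⟪ξ, X w⟫) := by nlinarith
  exact le_of_mul_le_mul_left h6 hpos

/-- A closed convex set is the intersection of its supporting half-spaces with bounded
functionals. -/
theorem mem_of_forall_inner_le (hK : Convex ℝ K) (hKc : IsClosed K) (hne : K.Nonempty)
    {x : EuclideanSpace ℝ (Fin n)}
    (hx : ∀ u b, u ≠ 0 → (∀ z ∈ K, ⟪u, z⟫ ≤ b) → ⟪u, x⟫ ≤ b) : x ∈ K := by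
  by_contra hxK
  obtain ⟨f, c, hf, hfx⟩ := geometric_hahn_banach_closed_point hK hKc hxK
  set u := (InnerProductSpace.toDual ℝ (EuclideanSpace ℝ (Fin n))).symm f with hu
  have hin : ∀ z, ⟪u, z⟫ = f z := fun z => by simp [hu]
  have hle : ⟪u, x⟫ ≤ c := by
    refine hx u c ?_ fun z hz => by rw [hin]; exact (hf z hz).le
    intro h0
    obtain ⟨z, hz⟩ := hne
    have h1 := hf z hz
    rw [← hin, h0, inner_zero_left] at h1 hfx
    linarith
  rw [hin] at hle
  linarith

end Asymptotic

/-! ### The barrier argument and attainment on the boundary of the copolar set -/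

section Boundary

open Filter

variable {n : ℕ} {K : Set (EuclideanSpace ℝ (Fin n))} {C : ProperCone ℝ (EuclideanSpace ℝ (Fin n))}

/-- Touching the support function of `K` from below by a quadratic function: there are a point
`x ∈ K` with normal vector `w` such that, on a slice of the polar cone, the support function grows
at least quadratically from its tangent at `w`. -/
theorem exists_maximizer_with_quadratic_growth (hne : K.Nonempty) (hconv : Convex ℝ K)
    (hclosed : IsClosed K) {e w₀ y : EuclideanSpace ℝ (Fin n)} {r δ ε β : ℝ} (hr : 0 < r)
    (hbd : ∀ u b, (∀ z ∈ K, ⟪u, z⟫ ≤ b) → (∀ z ∈ K, ⟪u, z⟫ ≤ 0) ∧ r * ‖u‖ ≤ -⟪u, e⟫)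
    (hw₀ : ⟪w₀, e⟫ = -1) (hw₀K : ∀ z ∈ K, ⟪w₀, z⟫ ≤ -(2 * δ)) (hδ : 0 < δ)
    (hw₀y : ⟪y, w₀⟫ = 0) (hy : ∀ w, (∀ z ∈ K, ⟪w, z⟫ ≤ 0) → ⟪y, w⟫ ≤ 0)
    (hε : 0 ≤ ε) (hεδ : 4 * ε ≤ δ * r ^ 2) (hβ : 0 ≤ β) :
    ∃ w x, ⟪w, e⟫ = -1 ∧ x ∈ K ∧ (∀ z ∈ K, ⟪w, z - x⟫ ≤ 0) ∧ ⟪w, x⟫ ≤ -δ ∧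
      ∀ w' x', ⟪w', e⟫ = -1 → x' ∈ K → (∀ z ∈ K, ⟪w', z - x'⟫ ≤ 0) →
        ⟪w', x⟫ + (ε * ‖w' - w‖ ^ 2 + β * ⟪y, w' - w⟫ ^ 2) ≤ ⟪w', x'⟫ := by
  have : Nonempty K := hne.to_subtype
  set Δ : Set (EuclideanSpace ℝ (Fin n)) := {w | ⟪w, e⟫ = -1 ∧ ∀ z ∈ K, ⟪w, z⟫ ≤ 0} with hΔ
  have hnorm : ∀ w ∈ Δ, ‖w‖ ≤ r⁻¹ := by
    intro w hw
    have h1 := (hbd w 0 hw.2).2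
    rw [hw.1, neg_neg] at h1
    rw [← one_div, le_div_iff₀ hr]
    linarith
  have hΔc : IsCompact Δ := by
    refine Metric.isCompact_of_isClosed_isBounded ?_ ?_
    · have h1 : Δ = {w | ⟪w, e⟫ = -1} ∩ ⋂ z ∈ K, {w | ⟪w, z⟫ ≤ 0} := by
        ext w; simp [hΔ]
      rw [h1]
      refine (isClosed_eq (by fun_prop) continuous_const).inter (isClosed_biInter fun z _ => ?_)
      exact isClosed_le (by fun_prop) continuous_const
    · exact (Metric.isBounded_closedBall (x := (0 : EuclideanSpace ℝ (Fin n))) (r := r⁻¹)).subset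
        fun w hw => by simpa using hnorm w hw
  have hw₀Δ : w₀ ∈ Δ := ⟨hw₀, fun z hz => (hw₀K z hz).trans (by linarith)⟩
  set h : EuclideanSpace ℝ (Fin n) → ℝ := fun w => ⨆ z : K, ⟪w, (z : EuclideanSpace ℝ (Fin n))⟫
    with hh
  have hbdd : ∀ w ∈ Δ, BddAbove (Set.range fun z : K => ⟪w, (z : EuclideanSpace ℝ (Fin n))⟫) := by
    rintro w hw
    refine ⟨0, ?_⟩
    rintro _ ⟨z, rfl⟩
    exact hw.2 z z.2
  have hle : ∀ w ∈ Δ, ∀ z ∈ K, ⟪w, z⟫ ≤ h w := fun w hw z hz => le_ciSup (hbdd w hw) ⟨z, hz⟩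
  have hsup : ∀ w b, (∀ z ∈ K, ⟪w, z⟫ ≤ b) → h w ≤ b := fun w b hb => ciSup_le fun z => hb z z.2
  -- On Δ, ⟨y, w⟩ lies between -‖y‖/r and 0. The linear term therefore makes the β part nonpositive
  -- for every β, while it vanishes at w₀; so v ≤ δ on Δ however large β is.
  set v : EuclideanSpace ℝ (Fin n) → ℝ := fun w =>
    ε * ‖w - w₀‖ ^ 2 + β * ⟪y, w⟫ ^ 2 + 2 * β * (‖y‖ * r⁻¹) * ⟪y, w⟫ with hv
  -- As a supremum of linear functions h is lower semicontinuous up to the boundary of the slice,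
  -- which suffices for a minimum.
  have hlsc : LowerSemicontinuousOn (fun w => h w + -v w) Δ := by
    refine LowerSemicontinuousOn.add ?_ ?_
    · exact lowerSemicontinuousOn_ciSup hbdd fun z =>
        (Continuous.lowerSemicontinuous (by fun_prop)).lowerSemicontinuousOn _
    · exact (Continuous.lowerSemicontinuous (by fun_prop)).lowerSemicontinuousOn _
  obtain ⟨w, hwΔ, hwmin⟩ := hlsc.exists_isMinOn ⟨w₀, hw₀Δ⟩ hΔc
  have hmin : ∀ w' ∈ Δ, h w + -v w ≤ h w' + -v w' := fun w' hw' => hwmin hw'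
  set g : EuclideanSpace ℝ (Fin n) :=
    (2 * ε) • (w - w₀) + (2 * β * ⟪y, w⟫ + 2 * β * (‖y‖ * r⁻¹)) • y with hg
  have hexp : ∀ w', v w' = v w + ⟪w' - w, g⟫ +
      (ε * ‖w' - w‖ ^ 2 + β * ⟪y, w' - w⟫ ^ 2) := by
    intro w'
    have h1 : ‖w' - w₀‖ ^ 2 = ‖w' - w‖ ^ 2 + 2 * ⟪w' - w, w - w₀⟫ + ‖w - w₀‖ ^ 2 := by
      rw [← norm_add_sq_real, sub_add_sub_cancel]
    have h2 : ⟪y, w'⟫ = ⟪y, w' - w⟫ + ⟪y, w⟫ := by rw [← inner_add_right, sub_add_cancel]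
    simp only [hv, hg, h1]
    rw [h2, inner_add_right, real_inner_smul_right, real_inner_smul_right,
      real_inner_comm y (w' - w)]
    ring
  have hwδ : h w ≤ -δ := by
    have h1 := hmin w₀ hw₀Δ
    have h2 : v w₀ = 0 := by simp [hv, hw₀y]
    have h3 : h w₀ ≤ -(2 * δ) := hsup _ _ hw₀K
    have h4 : v w ≤ δ := by
      have h5 : ‖w - w₀‖ ≤ 2 * r⁻¹ := by
        linarith [norm_sub_le w w₀, hnorm w hwΔ, hnorm w₀ hw₀Δ]
      have h6 : ε * ‖w - w₀‖ ^ 2 ≤ δ := by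
        calc ε * ‖w - w₀‖ ^ 2 ≤ ε * (2 * r⁻¹) ^ 2 := by gcongr
          _ = 4 * ε * (r⁻¹) ^ 2 := by ring
          _ ≤ δ * r ^ 2 * (r⁻¹) ^ 2 := by gcongr
          _ = δ := by field_simp
      have h7 : ⟪y, w⟫ ≤ 0 := hy w hwΔ.2
      have h8 : -(‖y‖ * r⁻¹) ≤ ⟪y, w⟫ := by
        have h9 := neg_le_of_abs_le (abs_real_inner_le_norm y w)
        have h10 : ‖y‖ * ‖w‖ ≤ ‖y‖ * r⁻¹ := by gcongr; exact hnorm w hwΔ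
        linarith
      have h11 : 0 ≤ ‖y‖ * r⁻¹ := by positivity
      have h12 : β * (⟪y, w⟫ * (⟪y, w⟫ + 2 * (‖y‖ * r⁻¹))) ≤ 0 :=
        mul_nonpos_of_nonneg_of_nonpos hβ
          (mul_nonpos_of_nonpos_of_nonneg h7 (by linarith))
      simp only [hv]
      linarith
    linarith
  -- The vector g is the gradient of v at w. The multiple of e turns the tangent of v, shifted to
  -- the value h w, into a linear functional on the slice.
  set x : EuclideanSpace ℝ (Fin n) := g + (⟪w, g⟫ - h w) • e with hx
  have hxin : ∀ w', ⟪w', e⟫ = -1 → ⟪w', x⟫ = h w + ⟪w' - w, g⟫ := by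
    intro w' hw'
    rw [hx, inner_add_right, real_inner_smul_right, hw', inner_sub_left]
    ring
  have htouch : ∀ w' ∈ Δ, ⟪w', x⟫ + (ε * ‖w' - w‖ ^ 2 + β * ⟪y, w' - w⟫ ^ 2) ≤ h w' := by
    intro w' hw'
    have h1 := hmin w' hw'
    rw [hexp w'] at h1
    rw [hxin w' hw'.1]
    linarith
  have hwx : ⟪w, x⟫ = h w := by rw [hxin w hwΔ.1, sub_self, inner_zero_left, add_zero]
  have hxK : x ∈ K := by
    refine mem_of_forall_inner_le hconv hclosed hne fun u b hu hub => ?_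
    obtain ⟨h1, h2⟩ := hbd u b hub
    have h3 : 0 < -⟪u, e⟫ := lt_of_lt_of_le (mul_pos hr (norm_pos_iff.2 hu)) h2
    have h4 : (-⟪u, e⟫)⁻¹ • u ∈ Δ := by
      refine ⟨?_, fun z hz => ?_⟩
      · rw [real_inner_smul_left, ← neg_inj, neg_neg, ← mul_neg, inv_mul_cancel₀ h3.ne']
      · rw [real_inner_smul_left]
        exact mul_nonpos_of_nonneg_of_nonpos (by positivity) (h1 z hz)
    have h5 := htouch _ h4
    have h6 : h ((-⟪u, e⟫)⁻¹ • u) ≤ (-⟪u, e⟫)⁻¹ * b := hsup _ _ fun z hz => by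
      rw [real_inner_smul_left]
      exact mul_le_mul_of_nonneg_left (hub z hz) (by positivity)
    have h7 : (-⟪u, e⟫)⁻¹ * ⟪u, x⟫ ≤ (-⟪u, e⟫)⁻¹ * b := by
      rw [← real_inner_smul_left]
      have : 0 ≤ ε * ‖(-⟪u, e⟫)⁻¹ • u - w‖ ^ 2 + β * ⟪y, (-⟪u, e⟫)⁻¹ • u - w⟫ ^ 2 := by positivity
      linarith
    exact le_of_mul_le_mul_left h7 (inv_pos.2 h3)
  refine ⟨w, x, hwΔ.1, hxK, fun z hz => ?_, by rw [hwx]; exact hwδ, fun w' x' hw' hx' hmax => ?_⟩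
  · rw [inner_sub_right, hwx]
    linarith [hle w hwΔ z hz]
  · have h1 : ∀ z ∈ K, ⟪w', z⟫ ≤ ⟪w', x'⟫ := fun z hz => by
      have := hmax z hz
      rw [inner_sub_right] at this
      linarith
    exact (htouch w' ⟨hw', (hbd w' _ h1).1⟩).trans (hsup _ _ h1)

/-- Take for e the centre of a ball of radius r in C: a functional bounded above on K is nonpositive
on C, hence on this ball. So the slice ⟨w, e⟩ = -1 of the polar cone is bounded by 1/r. -/
theorem exists_slice_bound (hK : IsCPseudoCone C K) :
    ∃ e : EuclideanSpace ℝ (Fin n), ∃ r : ℝ, 0 < r ∧ ∀ u b, (∀ z ∈ K, ⟪u, z⟫ ≤ b) →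
      (∀ y ∈ C, ⟪u, y⟫ ≤ 0) ∧ (∀ z ∈ K, ⟪u, z⟫ ≤ 0) ∧ r * ‖u‖ ≤ -⟪u, e⟫ := by
  obtain ⟨e, he⟩ := hK.interior_nonempty
  obtain ⟨r, hr, hball⟩ := Metric.nhds_basis_closedBall.mem_iff.1 (mem_interior_iff_mem_nhds.1 he)
  refine ⟨e, r, hr, fun u b hub => ?_⟩
  have hC : ∀ y ∈ C, ⟪u, y⟫ ≤ 0 := fun y hy =>
    inner_nonpos_of_mem_recessionCone hK.isPseudoCone.nonempty hub
      (by rw [hK.recessionCone_eq]; exact hy)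
  refine ⟨hC, fun z hz => hC z ?_, ?_⟩
  · have := hK.isPseudoCone.mem_recessionCone hz
    rwa [hK.recessionCone_eq] at this
  · rcases eq_or_ne u 0 with rfl | hu
    · simp
    have hpos : 0 < ‖u‖ := norm_pos_iff.2 hu
    have h1 : e + (r * ‖u‖⁻¹) • u ∈ C := by
      apply hball
      rw [Metric.mem_closedBall, dist_self_add_left, norm_smul, Real.norm_of_nonneg (by positivity),
        mul_assoc, inv_mul_cancel₀ hpos.ne', mul_one]
    have h2 := hC _ h1
    rw [inner_add_right, real_inner_smul_right, real_inner_self_eq_norm_sq] at h2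
    have h3 : r * ‖u‖⁻¹ * ‖u‖ ^ 2 = r * ‖u‖ := by field_simp
    linarith

/-- The pseudo-cone bounded by an affine hypersphere is asymptotic to its recession cone: the
copolar set does not meet the boundary of the polar cone. -/
theorem inner_neg_of_mem_copolar (hK : IsCPseudoCone C K) (hsphere : IsAffineHypersphereBoundary K)
    {u y : EuclideanSpace ℝ (Fin n)} (hu : u ∈ copolar K) (hy : y ∈ C) (hy0 : y ≠ 0) :
    ⟪u, y⟫ < 0 := by
  obtain ⟨e, r, hr, hbd⟩ := exists_slice_bound hK
  obtain ⟨c₀, hc₀⟩ := hsphere.equiaffineSupport_const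
  have hne := hK.isPseudoCone.nonempty
  have hconv := hK.isPseudoCone.convex
  refine lt_of_le_of_ne ((hbd u (-1) hu).1 y hy) fun huy => ?_
  have hu0 : u ≠ 0 := by
    rintro rfl
    obtain ⟨z, hz⟩ := hne
    have := hu z hz
    rw [inner_zero_left] at this
    linarith
  set s := -⟪u, e⟫ with hs
  have hspos : 0 < s := lt_of_lt_of_le (mul_pos hr (norm_pos_iff.2 hu0)) (hbd u (-1) hu).2.2
  set w₀ := s⁻¹ • u with hw₀def
  have hw₀ : ⟪w₀, e⟫ = -1 := by
    rw [hw₀def, real_inner_smul_left, ← neg_inj, neg_neg, ← mul_neg, ← hs,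
      inv_mul_cancel₀ hspos.ne']
  set δ := s⁻¹ / 2 with hδdef
  have hδ : 0 < δ := by positivity
  have hw₀K : ∀ z ∈ K, ⟪w₀, z⟫ ≤ -(2 * δ) := fun z hz => by
    rw [hw₀def, real_inner_smul_left, hδdef]
    have := mul_le_mul_of_nonneg_left (hu z hz) (inv_pos.2 hspos).le
    linarith
  have hw₀y : ⟪y, w₀⟫ = 0 := by
    rw [hw₀def, real_inner_smul_right, real_inner_comm, huy, mul_zero]
  have he0 : 0 < ‖e‖ := norm_pos_iff.2 (by rintro rfl; simp at hw₀)
  have hypos : 0 < ‖y‖ := norm_pos_iff.2 hy0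
  -- A bound below for the distance from y to the line ℝe, needed for all multiples of e because the
  -- touching point w is not known yet.
  set m := ‖y‖ / (1 + ‖w₀‖ * ‖e‖) with hm
  have hmpos : 0 < m := by positivity
  have hmle : ∀ a : ℝ, m ≤ ‖y + a • e‖ := by
    intro a
    have h1 : |a| ≤ ‖w₀‖ * ‖y + a • e‖ := by
      have h2 : ⟪w₀, y + a • e⟫ = -a := by
        rw [inner_add_right, real_inner_smul_right, hw₀, real_inner_comm, hw₀y]; ring
      have h3 := abs_real_inner_le_norm w₀ (y + a • e)
      rwa [h2, abs_neg] at h3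
    have h4 : ‖y‖ ≤ ‖y + a • e‖ + |a| * ‖e‖ := by
      have := norm_sub_le (y + a • e) (a • e)
      rwa [add_sub_cancel_right, norm_smul, Real.norm_eq_abs] at this
    rw [hm, div_le_iff₀ (by positivity)]
    have h5 := mul_le_mul_of_nonneg_right h1 he0.le
    linarith
  set ε := min 1 (δ * r ^ 2 / 4) with hεdef
  have hε : 0 < ε := lt_min one_pos (by positivity)
  have hε1 : ε ≤ 1 := min_le_left _ _
  have hεδ : 4 * ε ≤ δ * r ^ 2 := by linarith [min_le_right 1 (δ * r ^ 2 / 4)]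
  set c₁ := |c₀| + 1 with hc₁
  have hc₁pos : 0 < c₁ := by positivity
  -- Curvature bound at points x with normal w and ⟨w, x⟩ ≤ -δ: there |⟨x, ν⟩| ≥ δr, and the
  -- equiaffine support function equals c₀. The summand 1 in c₁ keeps the denominator positive.
  set κ₀ := (δ * r / c₁) ^ (n + 1) with hκ₀
  have hκ₀pos : 0 < κ₀ := by positivity
  -- Chosen so that the lower bound r κ₀ ε^(n-1) β m² equals ‖e‖^n + 1, above the upper bound ‖e‖^n.
  -- None of the other constants depends on w or β.
  set β := (‖e‖ ^ n + 1) / (r * κ₀ * ε ^ (n - 1) * m ^ 2) with hβ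
  have hβpos : 0 < β := by positivity
  obtain ⟨w, x, hwe, hxK, hmax, hwx, hgrow⟩ := exists_maximizer_with_quadratic_growth
    hne hconv hK.isPseudoCone.isClosed hr (fun u b hub => (hbd u b hub).2) hw₀ hw₀K hδ hw₀y
    (fun w hw => by rw [real_inner_comm]; exact (hbd w 0 hw).1 y hy) hε.le hεδ hβpos.le
  have hw0 : w ≠ 0 := by rintro rfl; simp at hwe
  have hwpos : 0 < ‖w‖ := norm_pos_iff.2 hw0
  have hwr : r ≤ ‖w‖⁻¹ := by
    have h1 : ∀ z ∈ K, ⟪w, z⟫ ≤ ⟪w, x⟫ := fun z hz => by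
      have := hmax z hz
      rw [inner_sub_right] at this
      linarith
    have h2 := (hbd w _ h1).2.2
    rw [hwe, neg_neg] at h2
    rwa [← one_div, le_div_iff₀ hwpos]
  have hwinv : ‖w‖⁻¹ ≤ ‖e‖ := by
    have h1 := abs_real_inner_le_norm w e
    rw [hwe, abs_neg, abs_one] at h1
    rw [← one_div, div_le_iff₀ hwpos]
    linarith
  obtain ⟨φ, hφ, hκ, hwN⟩ := hsphere.c2Plus.exists_defining_of_maximizer hxK hw0 hmax
  obtain ⟨X, hXc, hXw, hXmax, hD, hAD⟩ := hφ.exists_inverse_gauss hconv hκ.ne' hw0 hwN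
  set ν := levelNormal φ x with hν
  have hν1 : ‖ν‖ = 1 := norm_levelNormal hφ.gradient_ne_zero
  have hsymm := isSymmetric_fderiv_of_maximizer hXc hXmax
  have hDν : fderiv ℝ X w ν = 0 := by
    have h1 : ∀ v, ⟪v, fderiv ℝ X w ν⟫ = 0 := fun v => by
      have h2 : ⟪fderiv ℝ X w v, ν⟫ = ⟪v, fderiv ℝ X w ν⟫ := hsymm v ν
      rw [← h2, real_inner_comm, hD]
    exact inner_self_eq_zero.1 (h1 _)
  have hκlow : κ₀ ≤ gaussCurvature K x := by
    have h1 := hc₀ x (mem_frontier_of_maximizer hxK hw0 hmax)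
    rw [equiaffineSupport, hφ.outerUnitNormal_eq hconv] at h1
    set p := gaussCurvature K x ^ (1 / ((n : ℝ) + 1)) with hp
    have hppos : 0 < p := Real.rpow_pos_of_pos hκ _
    have h2 : ⟪x, ν⟫ = c₀ * p := by rw [← h1, div_mul_cancel₀ _ hppos.ne']
    have h3 : ⟪w, x⟫ = ‖w‖ * ⟪x, ν⟫ := by
      conv_lhs => rw [hwN, real_inner_smul_left, real_inner_comm]
    have h4 : ⟪x, ν⟫ = ‖w‖⁻¹ * ⟪w, x⟫ := by rw [h3]; field_simp
    have h5 : δ * r ≤ c₁ * p := by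
      have h6 : r * δ ≤ ‖w‖⁻¹ * -⟪w, x⟫ := by gcongr; linarith
      have h7 : -c₀ * p ≤ c₁ * p := by
        gcongr; linarith [neg_abs_le c₀]
      linarith
    have h8 : p ^ (n + 1) = gaussCurvature K x := by
      rw [hp, ← Real.rpow_natCast, ← Real.rpow_mul hκ.le]
      have : (1 / ((n : ℝ) + 1)) * ((n + 1 : ℕ) : ℝ) = 1 := by push_cast; field_simp
      rw [this, Real.rpow_one]
    rw [← h8, hκ₀]
    gcongr
    rw [div_le_iff₀ hc₁pos]
    linarith
  have hlow : ∀ ξ, ⟪ξ, e⟫ = 0 → ε * ‖ξ‖ ^ 2 + β * ⟪y, ξ⟫ ^ 2 ≤ ⟪fderiv ℝ X w ξ, ξ⟫ := by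
    intro ξ hξ
    refine le_inner_fderiv_of_growth (hXc.differentiableAt one_ne_zero) hXmax ?_
    filter_upwards [(tendsto_line w ξ).eventually hXmax] with t ht
    have h1 := hgrow (w + t • ξ) (X (w + t • ξ))
      (by rw [inner_add_left, real_inner_smul_left, hξ, hwe]; ring) ht.1 ht.2
    rw [add_sub_cancel_left, norm_smul, real_inner_smul_right, Real.norm_eq_abs, mul_pow, sq_abs]
      at h1
    rw [hXw]
    linarith
  have hdetlow := le_det_borderedMap (D := (fderiv ℝ X w).toLinearMap) hsymm hwN hwe hDν hε.le hε1
    hβpos.le hmpos (hmle ⟪y, w⟫) hlow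
  have hdet := det_borderedMap_mul_det_borderedMap_self (d := ‖w‖⁻¹)
    (A := (fderiv ℝ (levelNormal φ) x).toLinearMap) (D := (fderiv ℝ X w).toLinearMap)
    hν1 hφ.inner_levelNormal_fderiv hD hAD (inv_ne_zero hwpos.ne')
  rw [← hφ.gaussCurvature_eq hconv, finrank_euclideanSpace_fin] at hdet
  rw [finrank_euclideanSpace_fin] at hdetlow
  have h1 : r * (κ₀ * (ε ^ (n - 1) * (β * m ^ 2))) ≤ ‖e‖ ^ n := by
    calc r * (κ₀ * (ε ^ (n - 1) * (β * m ^ 2)))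
        ≤ ‖w‖⁻¹ * (gaussCurvature K x *
          LinearMap.det (borderedMap ν (fderiv ℝ X w).toLinearMap)) := by gcongr
      _ = ‖w‖⁻¹ ^ n := hdet
      _ ≤ ‖e‖ ^ n := by gcongr
  have h2 : r * (κ₀ * (ε ^ (n - 1) * (β * m ^ 2))) = ‖e‖ ^ n + 1 := by
    rw [hβ]; field_simp
  linarith

/-- Every boundary point of the copolar set is a normal vector of `K` at a point of `K`. -/
theorem exists_maximizer_of_mem_frontier_copolar (hK : IsCPseudoCone C K)
    (hsphere : IsAffineHypersphereBoundary K) {u : EuclideanSpace ℝ (Fin n)}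
    (hu : u ∈ frontier (copolar K)) : ∃ x ∈ K, ⟪u, x⟫ = -1 ∧ ∀ z ∈ K, ⟪u, z - x⟫ ≤ 0 := by
  have hclosed : IsClosed (copolar K) := by
    have h1 : copolar K = ⋂ z ∈ K, {w | ⟪w, z⟫ ≤ -1} := by ext w; simp [copolar]
    rw [h1]
    exact isClosed_biInter fun z _ => isClosed_le (by fun_prop) continuous_const
  have huK : u ∈ copolar K := hclosed.frontier_subset hu
  have hKC : ∀ z ∈ K, z ∈ C := fun z hz => by
    have := hK.isPseudoCone.mem_recessionCone hz
    rwa [hK.recessionCone_eq] at this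
  -- Strict negativity on C becomes uniform by compactness of C ∩ unit sphere. Hence ⟨u, ·⟩ can
  -- approach -1 only on a bounded part of K.
  obtain ⟨a, ha, hacone⟩ : ∃ a > 0, ∀ y ∈ C, a * ‖y‖ ≤ -⟪u, y⟫ := by
    have hcomp : IsCompact ((C : Set (EuclideanSpace ℝ (Fin n))) ∩ Metric.sphere 0 1) :=
      (isCompact_sphere _ _).inter_left C.isClosed
    rcases (((C : Set (EuclideanSpace ℝ (Fin n))) ∩ Metric.sphere 0 1)).eq_empty_or_nonempty
      with hemp | hnonemp
    · refine ⟨1, one_pos, fun y hy => ?_⟩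
      rcases eq_or_ne y 0 with rfl | hy0
      · simp
      · exfalso
        have h1 : ‖y‖⁻¹ • y ∈ (C : Set (EuclideanSpace ℝ (Fin n))) ∩ Metric.sphere 0 1 :=
          ⟨C.smul_mem hy (by positivity), by simp [norm_smul, hy0]⟩
        rw [hemp] at h1
        exact h1
    · obtain ⟨y₀, hy₀, hmin⟩ := hcomp.exists_isMinOn hnonemp
        (f := fun y => -⟪u, y⟫) (by fun_prop)
      have hy₀0 : y₀ ≠ 0 := by
        rintro rfl
        simpa using hy₀.2
      refine ⟨-⟪u, y₀⟫, neg_pos.2 (inner_neg_of_mem_copolar hK hsphere huK hy₀.1 hy₀0),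
        fun y hy => ?_⟩
      rcases eq_or_ne y 0 with rfl | hy0
      · simp
      · have hypos : 0 < ‖y‖ := norm_pos_iff.2 hy0
        have h1 : ‖y‖⁻¹ • y ∈ (C : Set (EuclideanSpace ℝ (Fin n))) ∩ Metric.sphere 0 1 :=
          ⟨C.smul_mem hy (by positivity), by simp [norm_smul, hy0]⟩
        have h2 : -⟪u, y₀⟫ ≤ -⟪u, ‖y‖⁻¹ • y⟫ := hmin h1
        rw [real_inner_smul_right] at h2
        have h3 := mul_le_mul_of_nonneg_right h2 hypos.le
        have h4 : -(‖y‖⁻¹ * ⟪u, y⟫) * ‖y‖ = -⟪u, y⟫ := by field_simp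
        linarith
  suffices hex : ∃ x ∈ K, -1 ≤ ⟪u, x⟫ by
    obtain ⟨x, hx, hxu⟩ := hex
    have h1 : ⟪u, x⟫ = -1 := le_antisymm (huK x hx) hxu
    refine ⟨x, hx, h1, fun z hz => ?_⟩
    rw [inner_sub_right, h1]
    linarith [huK z hz]
  by_contra! hlt
  apply hu.2
  rw [mem_interior_iff_mem_nhds, Metric.mem_nhds_iff]
  have hBc : IsCompact (K ∩ Metric.closedBall 0 (2 / a)) :=
    (isCompact_closedBall _ _).inter_left hK.isPseudoCone.isClosed
  obtain ⟨b, hb, hbound⟩ : ∃ b > 0, ∀ z ∈ K ∩ Metric.closedBall 0 (2 / a), ⟪u, z⟫ ≤ -1 - b := by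
    rcases (K ∩ Metric.closedBall 0 (2 / a)).eq_empty_or_nonempty with hemp | hnonemp
    · exact ⟨1, one_pos, fun z hz => by rw [hemp] at hz; exact hz.elim⟩
    · obtain ⟨z₀, hz₀, hmaxz⟩ := hBc.exists_isMaxOn hnonemp (f := fun z => ⟪u, z⟫) (by fun_prop)
      refine ⟨-1 - ⟪u, z₀⟫, by linarith [hlt z₀ hz₀.1], fun z hz => ?_⟩
      have : ⟪u, z⟫ ≤ ⟪u, z₀⟫ := hmaxz hz
      linarith
  -- If -1 is not attained, u is interior: for ‖z‖ ≤ 2/a the perturbation is at most b, and for ‖z‖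
  -- > 2/a it leaves ⟨w, z⟩ ≤ -(a/2)‖z‖ < -1.
  refine ⟨min (a / 2) (b * (a / 2)), lt_min (by positivity) (by positivity), fun w hw z hz => ?_⟩
  rw [Metric.mem_ball, dist_eq_norm] at hw
  have h1 : ⟪w, z⟫ = ⟪u, z⟫ + ⟪w - u, z⟫ := by rw [← inner_add_left, add_sub_cancel]
  have h2 : ⟪w - u, z⟫ ≤ ‖w - u‖ * ‖z‖ := real_inner_le_norm _ _
  rcases le_or_gt ‖z‖ (2 / a) with hz1 | hz1
  · have h3 := hbound z ⟨hz, by simpa using hz1⟩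
    have h4 : ‖w - u‖ * ‖z‖ ≤ (b * (a / 2)) * (2 / a) := by
      gcongr
      exact hw.le.trans (min_le_right _ _)
    have h5 : (b * (a / 2)) * (2 / a) = b := by field_simp
    linarith
  · have h3 := hacone z (hKC z hz)
    have h4 : ‖w - u‖ * ‖z‖ ≤ (a / 2) * ‖z‖ := by
      gcongr
      exact hw.le.trans (min_le_left _ _)
    have h5 : 2 < ‖z‖ * a := by rwa [div_lt_iff₀ ha] at hz1
    linarith

end Boundary

theorem mainTheorem4 {n : ℕ} (C : ProperCone ℝ (EuclideanSpace ℝ (Fin n)))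
    (K : Set (EuclideanSpace ℝ (Fin n))) (hK : IsCPseudoCone C K)
    (hsphere : IsAffineHypersphereBoundary K) :
    IsAffineHypersphereBoundary (copolar K) := by
  obtain ⟨c, hc⟩ := hsphere.equiaffineSupport_const
  have key : ∀ u ∈ frontier (copolar K), (∃ ψ, IsC2DefiningAt (copolar K) ψ u) ∧
      0 < gaussCurvature (copolar K) u ∧ equiaffineSupport (copolar K) u = c⁻¹ := by
    intro u hu
    obtain ⟨x, hx, hux, hmax⟩ := exists_maximizer_of_mem_frontier_copolar hK hsphere hu
    have hu0 : u ≠ 0 := by rintro rfl; simp at hux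
    obtain ⟨φ, hφ, hκ, huN⟩ := hsphere.c2Plus.exists_defining_of_maximizer hx hu0 hmax
    rw [← hc x (mem_frontier_of_maximizer hx hu0 hmax)]
    exact hφ.equiaffineSupport_copolar hK.isPseudoCone.convex hκ huN hux
  exact ⟨fun u hu => ⟨(key u hu).1, (key u hu).2.1⟩, c⁻¹, fun u hu => (key u hu).2.2⟩
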